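/- Let $L$ be the first-order language with equality, the relation symbol $\le$, and function symbols for all $\mathrm{TC}^0$ functions, given as follows: $0$, successor, $+$, $\cdot$, $\lfloor x/2\rfloor$, the binary length $|x|$, $x\# y=2^{|x||y|}$, truncated subtraction, $\mathrm{MSP}(x,i)=\lfloor x/2^i\rfloor$ and all projections are symbols, and the symbols are closed under composition, under sharply bounded minimization ($z,\vec v\mapsto$ the least $i<|z|$ with $f(i,\vec v)\ne0$, or $|z|$ if there is none), under bit comprehension ($z,\vec v\mapsto\sum_{i<|z|,\,f(i,\vec v)\ne0}2^i$) and under counting ($z,\vec v\mapsto\#\{i<|z|:f(i,\vec v)\ne0\}$). Let $\mathrm{BTC}^0$ be the universal $L$-theory axiomatized by Buss's $\mathrm{BASIC}$ together with the natural universal defining axioms of the remaining symbols. Here are the latter, for truncated subtraction $\dot-$, for $\mathrm{MSP}$, and for the functions $\mu_f,C_f,N_f$ obtained from $f$ by minimization, comprehension and counting: - $y\le x\to(x\mathbin{\dot-}y)+y=x$; $\ x\le y\to x\mathbin{\dot-}y=0$; $\ \mathrm{MSP}(x,0)=x$; $\ \mathrm{MSP}(x,i+1)=\lfloor\mathrm{MSP}(x,i)/2\rfloor$;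 $\ |x|\le i\to\mathrm{MSP}(x,i)=0$; the defining equations of projections and compositions; - $\mu_f(z,\vec v)\le|z|$; $\ \mu_f(z,\vec v)\ne|z|\to f(\mu_f(z,\vec v),\vec v)\ne0$; $\ i<\mu_f(z,\vec v)\to f(i,\vec v)=0$; - $C_f(z,\vec v)<1\# z$; $\ \mathrm{MSP}(C_f(z,\vec v),i)$ is odd if and only if $i<|z|$ and $f(i,\vec v)\ne0$; - $N_f(0,\vec v)=0$; for $z\ne0$, $N_f(z,\vec v)$ equals $N_f(\lfloor z/2\rfloor,\vec v)+1$ if $f(|\lfloor z/2\rfloor|,\vec v)\ne0$, and $N_f(\lfloor z/2\rfloor,\vec v)$ otherwise; $\ N_f(z,\vec v)\le|z|$. For a set $\Gamma$ of $L$-sentences and a sentence $\varphi$, write $\Gamma\vdash\varphi$ if $\varphi$ is provable in first-order logic from $\mathrm{BTC}^0\cup\Gamma$. A *theory* is a set $T$ of $L$-sentences such that $T\vdash\varphi$ implies $\varphi\in T$. The theory axiomatized by $\Gamma$ is $\{\varphi:\Gamma\vdash\varphi\}$. A *bounded quantifier* is one of the form $\forall y\le t$ or $\exists y\le t$ with $t$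 a term not containing $y$; it is *sharply bounded* if $t$ is of the form $|s|$. A formula is (sharply) bounded if all its quantifiers are. Let $\hat\Sigma_0=\hat\Pi_0$ be the class of sharply bounded formulas. For $i>0$, a $\hat\Pi_i$ formula ($\hat\Sigma_i$ formula) consists of $i$ alternating, possibly empty, blocks of bounded quantifiers, the first block being universal (existential), followed by a sharply bounded formula. Let $\Pi_1^+$ be the least class of formulas that includes all bounded formulas and is closed under universal quantifiers and bounded existential quantifiers. A theory is *$\Pi_1^+$-axiomatized* if it is axiomatized by a set of $\Pi_1^+$ sentences. A *rule* $R$ is a set of pairs $\Gamma/\varphi$, where $\Gamma$ is a finite set of sentences and $\varphi$ is a sentence. For a theory $T$, let $T+R$ be the least theory $T'\supseteq T$ closed under $R$, i.e., such that $\Gamma/\varphi\in R$ and $\Gamma\subseteq T'$ imply $\varphi\in T'$. Let $[T,R]$ be the theory axiomatized by $T\cup\{\varphi:\Gamma/\varphi\in R,\ T\vdash\Gamma\}$ (closure under unnested applications of $R$). The rule $\hat\Pi_i\text{-}\mathrm{IND}^R$ consists of all instances $$\frac{\varphi(0,\vec y)\qquad \varphi(x,\vec y)\to\varphi(x+1,\vec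 y)}{\varphi(x,\vec y)},$$ and the rule $\hat\Pi_i\text{-}\mathrm{PIND}^R$ of all instances $$\frac{\varphi(0,\vec y)\qquad \varphi(\lfloor x/2\rfloor,\vec y)\to\varphi(x,\vec y)}{\varphi(x,\vec y)},$$ where $\varphi(x,\vec y)$ is a $\hat\Pi_i$ formula with an arbitrary finite tuple $\vec y$ of parameters, and all formulas stand for their universal closures. **Theorem.** Let $T$ be a $\Pi_1^+$-axiomatized theory and $i>0$. Then $$T+\hat\Pi_i\text{-}\mathrm{IND}^R=[T,\hat\Pi_i\text{-}\mathrm{IND}^R]\qquad\text{and}\qquad T+\hat\Pi_i\text{-}\mathrm{PIND}^R=[T,\hat\Pi_i\text{-}\mathrm{PIND}^R].$$ -/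

import Mathlib

open FirstOrder

namespace BoundedArithmetic

/-! ### The language -/

/-- Function symbols, indexed by arity: the basic symbols of bounded arithmetic, closed under
composition, sharply bounded minimization, bit comprehension and counting. In the standard
interpretation these denote exactly the (uniform) `TC⁰` functions:
* `msp x i = ⌊x / 2 ^ i⌋`, `monus` is truncated subtraction, `smash x y = 2 ^ (|x| * |y|)`;
* `search f (z, v)` is the least `i < |z|` such that `f (i, v) ≠ 0`, or `|z|` if there is none;
* `compr f (z, v)` is the sum of `2 ^ i` over all `i < |z|` such that `f (i, v) ≠ 0`;
* `count f (z, v)` is the number of `i < |z|` such that `f (i, v) ≠ 0`. -/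
inductive TCFunc : ℕ → Type
  | zero : TCFunc 0
  | succ : TCFunc 1
  | half : TCFunc 1
  | len : TCFunc 1
  | add : TCFunc 2
  | mul : TCFunc 2
  | smash : TCFunc 2
  | monus : TCFunc 2
  | msp : TCFunc 2
  | proj {n : ℕ} (j : Fin n) : TCFunc n
  | comp {k n : ℕ} (f : TCFunc k) (g : Fin k → TCFunc n) : TCFunc n
  | search {n : ℕ} (f : TCFunc (n + 1)) : TCFunc (n + 1)
  | compr {n : ℕ} (f : TCFunc (n + 1)) : TCFunc (n + 1)
  | count {n : ℕ} (f : TCFunc (n + 1)) : TCFunc (n + 1)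

/-- The only relation symbol (besides equality) is the binary symbol `≤`. -/
inductive TCRel : ℕ → Type
  | le : TCRel 2

/-- The first-order language with function symbols for all `TC⁰` functions. -/
def LTC : FirstOrder.Language.{0, 0} := ⟨TCFunc, TCRel⟩

section Terms

variable {α : Type}

/-- Application of a function symbol to terms. -/
def app {n : ℕ} (f : TCFunc n) (ts : Fin n → LTC.Term α) : LTC.Term α :=
  FirstOrder.Language.Term.func (L := LTC) f ts

def tZero : LTC.Term α := app .zero ![]
def tSucc (s : LTC.Term α) : LTC.Term α := app .succ ![s]
def tHalf (s : LTC.Term α) : LTC.Term α := app .half ![s]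
def tLen (s : LTC.Term α) : LTC.Term α := app .len ![s]
def tAdd (s t : LTC.Term α) : LTC.Term α := app .add ![s, t]
def tMul (s t : LTC.Term α) : LTC.Term α := app .mul ![s, t]
def tSmash (s t : LTC.Term α) : LTC.Term α := app .smash ![s, t]
def tMonus (s t : LTC.Term α) : LTC.Term α := app .monus ![s, t]
def tMsp (s t : LTC.Term α) : LTC.Term α := app .msp ![s, t]

/-- The numeral `1`. -/
def tOne : LTC.Term α := tSucc tZero

/-- `2 * s` -/
def tDbl (s : LTC.Term α) : LTC.Term α := tMul (tSucc tOne) s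

/-- The atomic formula `s ≤ t`. -/
def leF {k : ℕ} (s t : LTC.Term (α ⊕ Fin k)) : LTC.BoundedFormula α k :=
  FirstOrder.Language.BoundedFormula.rel (L := LTC) TCRel.le ![s, t]

end Terms

/-- The universal closure of a formula whose free variables are indexed by `Fin n`. -/
def univClosure {n : ℕ} (φ : LTC.Formula (Fin n)) : LTC.Sentence :=
  (FirstOrder.Language.BoundedFormula.relabel (Sum.inr : Fin n → Empty ⊕ Fin n) φ).alls

/-! ### The base theory -/

section Axioms

variable {n : ℕ}

/-- The `j`th free variable, as a term. -/
def v (j : Fin n) : LTC.Term (Fin n ⊕ Fin 0) := FirstOrder.Language.Term.var (Sum.inl j)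

/-- `s = t` as a quantifier-free formula. -/
def eqF (s t : LTC.Term (Fin n ⊕ Fin 0)) : LTC.Formula (Fin n) := s =' t

/-- Bit number `i` of `s` is `1`, that is, `⌊s / 2 ^ i⌋` is odd. -/
def bitF (s i : LTC.Term (Fin n ⊕ Fin 0)) : LTC.Formula (Fin n) :=
  eqF (tMsp s i) (tSucc (tDbl (tHalf (tMsp s i))))

/-- The `j`th of the first `k` variables, where the last `n` variables are parameters. -/
def hd {k : ℕ} (j : Fin k) : LTC.Term (Fin (k + n) ⊕ Fin 0) := v (Fin.castAdd n j)

/-- `f (s, x₀, …, xₙ₋₁)` where the parameters `x` are the last `n` of the `k + n` variables. -/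
def appPar {k : ℕ} (f : TCFunc (n + 1)) (s : LTC.Term (Fin (k + n) ⊕ Fin 0)) :
    LTC.Term (Fin (k + n) ⊕ Fin 0) :=
  app f (Fin.cons s fun j => v (Fin.natAdd k j))

/-- The axioms of the base theory, as quantifier-free formulas. They consist of the 32 axioms
`BASIC` of Buss, axioms for `∸` and `MSP`, and defining axioms for the remaining symbols. -/
inductive BTCAxiom : (n : ℕ) → LTC.Formula (Fin n) → Prop
  -- Buss's `BASIC`
  | le_succ : BTCAxiom 2 (leF (v 1) (v 0) ⟹ leF (v 1) (tSucc (v 0)))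
  | ne_succ : BTCAxiom 1 (∼(eqF (v 0) (tSucc (v 0))))
  | zero_le : BTCAxiom 1 (leF tZero (v 0))
  | succ_le : BTCAxiom 2 ((leF (v 0) (v 1) ⊓ ∼(eqF (v 0) (v 1))) ⇔ leF (tSucc (v 0)) (v 1))
  | dbl_ne : BTCAxiom 1 (∼(eqF (v 0) tZero) ⟹ ∼(eqF (tDbl (v 0)) tZero))
  | le_total : BTCAxiom 2 (leF (v 0) (v 1) ⊔ leF (v 1) (v 0))
  | le_antisymm : BTCAxiom 2 ((leF (v 0) (v 1) ⊓ leF (v 1) (v 0)) ⟹ eqF (v 0) (v 1))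
  | le_trans : BTCAxiom 3 ((leF (v 0) (v 1) ⊓ leF (v 1) (v 2)) ⟹ leF (v 0) (v 2))
  | len_zero : BTCAxiom 0 (eqF (tLen tZero) tZero)
  | len_dbl : BTCAxiom 1 (∼(eqF (v 0) tZero) ⟹
      (eqF (tLen (tDbl (v 0))) (tSucc (tLen (v 0))) ⊓
        eqF (tLen (tSucc (tDbl (v 0)))) (tSucc (tLen (v 0)))))
  | len_one : BTCAxiom 0 (eqF (tLen tOne) tOne)
  | len_mono : BTCAxiom 2 (leF (v 0) (v 1) ⟹ leF (tLen (v 0)) (tLen (v 1)))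
  | len_smash : BTCAxiom 2
      (eqF (tLen (tSmash (v 0) (v 1))) (tSucc (tMul (tLen (v 0)) (tLen (v 1)))))
  | zero_smash : BTCAxiom 1 (eqF (tSmash tZero (v 0)) tOne)
  | one_smash : BTCAxiom 1 (∼(eqF (v 0) tZero) ⟹
      (eqF (tSmash tOne (tDbl (v 0))) (tDbl (tSmash tOne (v 0))) ⊓
        eqF (tSmash tOne (tSucc (tDbl (v 0)))) (tDbl (tSmash tOne (v 0)))))
  | smash_comm : BTCAxiom 2 (eqF (tSmash (v 0) (v 1)) (tSmash (v 1) (v 0)))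
  | smash_congr : BTCAxiom 3 (eqF (tLen (v 0)) (tLen (v 1)) ⟹
      eqF (tSmash (v 0) (v 2)) (tSmash (v 1) (v 2)))
  | smash_add : BTCAxiom 4 (eqF (tLen (v 0)) (tAdd (tLen (v 1)) (tLen (v 2))) ⟹
      eqF (tSmash (v 0) (v 3)) (tMul (tSmash (v 1) (v 3)) (tSmash (v 2) (v 3))))
  | le_add : BTCAxiom 2 (leF (v 0) (tAdd (v 0) (v 1)))
  | dbl_lt : BTCAxiom 2 ((leF (v 0) (v 1) ⊓ ∼(eqF (v 0) (v 1))) ⟹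
      (leF (tSucc (tDbl (v 0))) (tDbl (v 1)) ⊓ ∼(eqF (tSucc (tDbl (v 0))) (tDbl (v 1)))))
  | add_comm : BTCAxiom 2 (eqF (tAdd (v 0) (v 1)) (tAdd (v 1) (v 0)))
  | add_zero : BTCAxiom 1 (eqF (tAdd (v 0) tZero) (v 0))
  | add_succ : BTCAxiom 2 (eqF (tAdd (v 0) (tSucc (v 1))) (tSucc (tAdd (v 0) (v 1))))
  | add_assoc : BTCAxiom 3
      (eqF (tAdd (tAdd (v 0) (v 1)) (v 2)) (tAdd (v 0) (tAdd (v 1) (v 2))))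
  | add_le_add : BTCAxiom 3
      (leF (tAdd (v 0) (v 1)) (tAdd (v 0) (v 2)) ⇔ leF (v 1) (v 2))
  | mul_zero : BTCAxiom 1 (eqF (tMul (v 0) tZero) tZero)
  | mul_succ : BTCAxiom 2 (eqF (tMul (v 0) (tSucc (v 1))) (tAdd (tMul (v 0) (v 1)) (v 0)))
  | mul_comm : BTCAxiom 2 (eqF (tMul (v 0) (v 1)) (tMul (v 1) (v 0)))
  | mul_add : BTCAxiom 3
      (eqF (tMul (v 0) (tAdd (v 1) (v 2))) (tAdd (tMul (v 0) (v 1)) (tMul (v 0) (v 2))))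
  | mul_le_mul : BTCAxiom 3 (leF tOne (v 0) ⟹
      (leF (tMul (v 0) (v 1)) (tMul (v 0) (v 2)) ⇔ leF (v 1) (v 2)))
  | len_half : BTCAxiom 1 (∼(eqF (v 0) tZero) ⟹ eqF (tLen (v 0)) (tSucc (tLen (tHalf (v 0)))))
  | half_iff : BTCAxiom 2 (eqF (v 0) (tHalf (v 1)) ⇔
      (eqF (tDbl (v 0)) (v 1) ⊔ eqF (tSucc (tDbl (v 0))) (v 1)))
  -- truncated subtraction and `MSP`
  | monus_add : BTCAxiom 2 (leF (v 1) (v 0) ⟹ eqF (tAdd (tMonus (v 0) (v 1)) (v 1)) (v 0))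
  | monus_zero : BTCAxiom 2 (leF (v 0) (v 1) ⟹ eqF (tMonus (v 0) (v 1)) tZero)
  | msp_zero : BTCAxiom 1 (eqF (tMsp (v 0) tZero) (v 0))
  | msp_succ : BTCAxiom 2 (eqF (tMsp (v 0) (tSucc (v 1))) (tHalf (tMsp (v 0) (v 1))))
  | msp_large : BTCAxiom 2 (leF (tLen (v 0)) (v 1) ⟹ eqF (tMsp (v 0) (v 1)) tZero)
  -- projections and composition
  | proj {n : ℕ} (j : Fin n) : BTCAxiom n (eqF (app (.proj j) v) (v j))
  | comp {k n : ℕ} (f : TCFunc k) (g : Fin k → TCFunc n) :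
      BTCAxiom n (eqF (app (.comp f g) v) (app f fun j => app (g j) v))
  -- sharply bounded minimization (variables: `z, i, x₀, …, xₙ₋₁`)
  | search_le {n : ℕ} (f : TCFunc (n + 1)) :
      BTCAxiom (1 + n) (leF (appPar (.search f) (hd 0)) (tLen (hd 0)))
  | search_spec {n : ℕ} (f : TCFunc (n + 1)) :
      BTCAxiom (1 + n) (∼(eqF (appPar (.search f) (hd 0)) (tLen (hd 0))) ⟹
        ∼(eqF (appPar f (appPar (.search f) (hd 0))) tZero))
  | search_min {n : ℕ} (f : TCFunc (n + 1)) :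
      BTCAxiom (2 + n) (leF (tSucc (hd 1)) (appPar (.search f) (hd 0))
        ⟹ eqF (appPar f (hd 1)) tZero)
  -- bit comprehension; `1 # z = 2 ^ |z|`
  | compr_lt {n : ℕ} (f : TCFunc (n + 1)) :
      BTCAxiom (1 + n) (leF (tSucc (appPar (.compr f) (hd 0))) (tSmash tOne (hd 0)))
  | compr_bit {n : ℕ} (f : TCFunc (n + 1)) :
      BTCAxiom (2 + n) (bitF (appPar (.compr f) (hd 0)) (hd 1) ⇔
        (leF (tSucc (hd 1)) (tLen (hd 0)) ⊓
          ∼(eqF (appPar f (hd 1)) tZero)))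
  -- counting, by recursion on `|z|`
  | count_zero {n : ℕ} (f : TCFunc (n + 1)) :
      BTCAxiom (0 + n) (eqF (appPar (.count f) tZero) tZero)
  | count_step {n : ℕ} (f : TCFunc (n + 1)) :
      BTCAxiom (1 + n) ((∼(eqF (hd 0) tZero) ⊓ ∼(eqF (appPar f (tLen (tHalf (hd 0)))) tZero)) ⟹
        eqF (appPar (.count f) (hd 0)) (tSucc (appPar (.count f) (tHalf (hd 0)))))
  | count_skip {n : ℕ} (f : TCFunc (n + 1)) :
      BTCAxiom (1 + n) ((∼(eqF (hd 0) tZero) ⊓ eqF (appPar f (tLen (tHalf (hd 0)))) tZero) ⟹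
        eqF (appPar (.count f) (hd 0)) (appPar (.count f) (tHalf (hd 0))))
  | count_le {n : ℕ} (f : TCFunc (n + 1)) :
      BTCAxiom (1 + n) (leF (appPar (.count f) (hd 0)) (tLen (hd 0)))

end Axioms

/-- The axioms of the universal base theory for `TC⁰`. -/
def BTC : LTC.Theory := {σ | ∃ (n : ℕ) (φ : LTC.Formula (Fin n)), BTCAxiom n φ ∧ σ = univClosure φ}

/-! ### Provability and theories -/

/-- `Provable Γ σ`: the sentence `σ` is provable in the base theory extended by `Γ`, i.e., it
belongs to the least set of sentences containing the base theory, `Γ`, and all logically valid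
sentences, and closed under modus ponens. -/
inductive Provable (Γ : LTC.Theory) : LTC.Sentence → Prop
  | base {σ : LTC.Sentence} (h : σ ∈ BTC) : Provable Γ σ
  | hyp {σ : LTC.Sentence} (h : σ ∈ Γ) : Provable Γ σ
  | valid {σ : LTC.Sentence} (h : FirstOrder.Language.Theory.ModelsBoundedFormula (∅ : LTC.Theory) σ) :
      Provable Γ σ
  | mp {σ τ : LTC.Sentence} (h₁ : Provable Γ (σ.imp τ)) (h₂ : Provable Γ σ) : Provable Γ τ

/-- The theory axiomatized (over the base theory) by `Γ`. -/
def Cn (Γ : LTC.Theory) : LTC.Theory := {σ | Provable Γ σ}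

/-- Theories are deductively closed sets of sentences (including the base theory). -/
def IsTheory (T : LTC.Theory) : Prop := ∀ σ, Provable T σ → σ ∈ T

/-! ### Classes of formulas -/

section Classes

variable {α : Type}

/-- The formula `y ≤ t`, where `y` is the last bound variable and `t` does not contain `y`. -/
def boundF {k : ℕ} (t : LTC.Term (α ⊕ Fin k)) : LTC.BoundedFormula α (k + 1) :=
  leF (FirstOrder.Language.Term.var (Sum.inr (Fin.last k)))
    (FirstOrder.Language.Term.relabel (Sum.map id Fin.castSucc) t)

/-- `∀ y ≤ t, φ` -/
def ballF {k : ℕ} (t : LTC.Term (α ⊕ Fin k)) (φ : LTC.BoundedFormula α (k + 1)) :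
    LTC.BoundedFormula α k := ∀' (boundF t ⟹ φ)

/-- `∃ y ≤ t, φ` -/
def bexF {k : ℕ} (t : LTC.Term (α ⊕ Fin k)) (φ : LTC.BoundedFormula α (k + 1)) :
    LTC.BoundedFormula α k := ∃' (boundF t ⊓ φ)

/-- Bounded formulas. -/
inductive IsBounded : {k : ℕ} → LTC.BoundedFormula α k → Prop
  | falsum {k : ℕ} : IsBounded (⊥ : LTC.BoundedFormula α k)
  | eq {k : ℕ} (s t : LTC.Term (α ⊕ Fin k)) : IsBounded (s =' t)
  | le {k : ℕ} (s t : LTC.Term (α ⊕ Fin k)) : IsBounded (leF s t)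
  | imp {k : ℕ} {φ ψ : LTC.BoundedFormula α k} (h₁ : IsBounded φ) (h₂ : IsBounded ψ) :
      IsBounded (φ ⟹ ψ)
  | ball {k : ℕ} (t : LTC.Term (α ⊕ Fin k)) {φ : LTC.BoundedFormula α (k + 1)}
      (h : IsBounded φ) : IsBounded (ballF t φ)
  | bex {k : ℕ} (t : LTC.Term (α ⊕ Fin k)) {φ : LTC.BoundedFormula α (k + 1)}
      (h : IsBounded φ) : IsBounded (bexF t φ)

/-- Sharply bounded formulas: all quantifiers are bounded by terms of the form `|t|`. -/
inductive IsSharplyBounded : {k : ℕ} → LTC.BoundedFormula α k → Prop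
  | falsum {k : ℕ} : IsSharplyBounded (⊥ : LTC.BoundedFormula α k)
  | eq {k : ℕ} (s t : LTC.Term (α ⊕ Fin k)) : IsSharplyBounded (s =' t)
  | le {k : ℕ} (s t : LTC.Term (α ⊕ Fin k)) : IsSharplyBounded (leF s t)
  | imp {k : ℕ} {φ ψ : LTC.BoundedFormula α k} (h₁ : IsSharplyBounded φ)
      (h₂ : IsSharplyBounded ψ) : IsSharplyBounded (φ ⟹ ψ)
  | ball {k : ℕ} (t : LTC.Term (α ⊕ Fin k)) {φ : LTC.BoundedFormula α (k + 1)}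
      (h : IsSharplyBounded φ) : IsSharplyBounded (ballF (tLen t) φ)
  | bex {k : ℕ} (t : LTC.Term (α ⊕ Fin k)) {φ : LTC.BoundedFormula α (k + 1)}
      (h : IsSharplyBounded φ) : IsSharplyBounded (bexF (tLen t) φ)

/-- The kind of the first block of quantifiers. -/
inductive Kind
  | sigma
  | pi

/-- Strict `Σᵇᵢ` and `Πᵇᵢ` formulas: `i` alternating, possibly empty, blocks of bounded
quantifiers followed by a sharply bounded formula. -/
inductive IsStrict : Kind → ℕ → {k : ℕ} → LTC.BoundedFormula α k → Prop
  | sharp {c : Kind} {k : ℕ} {φ : LTC.BoundedFormula α k} (h : IsSharplyBounded φ) :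
      IsStrict c 0 φ
  | sigma {i k : ℕ} {φ : LTC.BoundedFormula α k} (h : IsStrict .pi i φ) :
      IsStrict .sigma (i + 1) φ
  | pi {i k : ℕ} {φ : LTC.BoundedFormula α k} (h : IsStrict .sigma i φ) :
      IsStrict .pi (i + 1) φ
  | bex {i k : ℕ} (t : LTC.Term (α ⊕ Fin k)) {φ : LTC.BoundedFormula α (k + 1)}
      (h : IsStrict .sigma (i + 1) φ) : IsStrict .sigma (i + 1) (bexF t φ)
  | ball {i k : ℕ} (t : LTC.Term (α ⊕ Fin k)) {φ : LTC.BoundedFormula α (k + 1)}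
      (h : IsStrict .pi (i + 1) φ) : IsStrict .pi (i + 1) (ballF t φ)

/-- Strict `Πᵇᵢ` formulas. -/
def IsPiHat (i : ℕ) {k : ℕ} (φ : LTC.BoundedFormula α k) : Prop := IsStrict .pi i φ

/-- `Π₁⁺` formulas: the least class including bounded formulas and closed under universal and
bounded existential quantifiers. -/
inductive IsPiPlus : {k : ℕ} → LTC.BoundedFormula α k → Prop
  | bounded {k : ℕ} {φ : LTC.BoundedFormula α k} (h : IsBounded φ) : IsPiPlus φ
  | all {k : ℕ} {φ : LTC.BoundedFormula α (k + 1)} (h : IsPiPlus φ) : IsPiPlus (∀' φ)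
  | bex {k : ℕ} (t : LTC.Term (α ⊕ Fin k)) {φ : LTC.BoundedFormula α (k + 1)}
      (h : IsPiPlus φ) : IsPiPlus (bexF t φ)

end Classes

/-- `T` is axiomatized, over the base theory, by a set of `Π₁⁺` sentences. -/
def IsPiPlusAxiomatized (T : LTC.Theory) : Prop :=
  ∃ Γ : LTC.Theory, (∀ σ ∈ Γ, IsPiPlus σ) ∧ T = Cn Γ

/-! ### Rules -/

/-- An instance `Γ / σ` of a rule: a finite set of sentences `Γ` and a sentence `σ`. -/
structure RuleInstance where
  premises : Set LTC.Sentence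
  finite : premises.Finite
  conclusion : LTC.Sentence

/-- A rule is a set of instances. -/
abbrev Rule := Set RuleInstance

/-- A set of sentences is closed under a rule. -/
def ClosedUnder (R : Rule) (T : LTC.Theory) : Prop :=
  ∀ r ∈ R, r.premises ⊆ T → r.conclusion ∈ T

/-- `T + R`: the least theory including `T` and closed under `R`. -/
def ruleClosure (T : LTC.Theory) (R : Rule) : LTC.Theory :=
  ⋂₀ {T' | IsTheory T' ∧ T ⊆ T' ∧ ClosedUnder R T'}

/-- `[T, R]`: the closure of `T` under unnested applications of instances of `R`. -/
def unnestedClosure (T : LTC.Theory) (R : Rule) : LTC.Theory :=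
  Cn (T ∪ {σ | ∃ r ∈ R, (∀ τ ∈ r.premises, Provable T τ) ∧ σ = r.conclusion})

/-- The formula `φ(s, y)`, where variable `0` of `φ` is the induction variable `x`, the other
variables `y` are parameters, and `s` is a term in the variables `x, y`. -/
def instF {n : ℕ} (φ : LTC.Formula (Fin (n + 1))) (s : LTC.Term (Fin (n + 1))) :
    LTC.Formula (Fin (n + 1)) :=
  FirstOrder.Language.BoundedFormula.subst φ
    (Fin.cons s fun j : Fin n => FirstOrder.Language.Term.var j.succ)

/-- The induction rule for strict `Πᵇᵢ` formulas (with parameters `y`):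
from `φ(0, y)` and `φ(x, y) → φ(x + 1, y)` infer `φ(x, y)`. -/
def piHatIND (i : ℕ) : Rule :=
  {r | ∃ (n : ℕ) (φ : LTC.Formula (Fin (n + 1))), IsPiHat i φ ∧
    r.premises = {univClosure (instF φ tZero),
      univClosure (φ.imp (instF φ (tSucc (FirstOrder.Language.Term.var 0))))} ∧
    r.conclusion = univClosure φ}

/-- The polynomial induction rule for strict `Πᵇᵢ` formulas (with parameters `y`):
from `φ(0, y)` and `φ(⌊x / 2⌋, y) → φ(x, y)` infer `φ(x, y)`. -/
def piHatPIND (i : ℕ) : Rule :=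
  {r | ∃ (n : ℕ) (φ : LTC.Formula (Fin (n + 1))), IsPiHat i φ ∧
    r.premises = {univClosure (instF φ tZero),
      univClosure ((instF φ (tHalf (FirstOrder.Language.Term.var 0))).imp φ)} ∧
    r.conclusion = univClosure φ}

end BoundedArithmetic

/-! Unnested applications are available in T + R by definition, so the point is that [T, R] is
already closed under R. Let φ be a formula whose premises are provable in [T, R]. Over T they follow
from the universal closures of formulas ψ_j, each of which is inductive (satisfies the premises of
the rule) over T itself.

Parikh's argument makes this dependence finite and bounded. As T is Π₁⁺-axiomatized, the elements
lying below values of terms at given parameters again form a model of T. Compactness then gives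
finitely many ψ_p and terms such that each instance of the premises of φ follows over T from these
ψ_p restricted below the terms (`exists_bounding_terms`). Every function symbol has a monotone
bounding term, so one term b majorizes all of these.

The two inductions are then run one after the other on one clock. Every u is reached from 0 through
stages `approx u k`, with `approx u k = u` once k ≥ `time u`. For k = `time a`, let χ(a, w) say that
(A) every listed ψ_p holds at stage k of each of its arguments below b(w), and (B) if k ≥ `time
b(w)`, then φ holds at stage k - `time b(w)` of w₀. When (B) becomes active, (A) says that the ψ_p
hold everywhere below b(w), so the premises of φ are true for all x ≤ w₀ and φ can start at 0 and
advance. Hence χ is inductive over T alone, and choosing a with `time a` ≥ `time w₀` + `time b(w)`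
yields φ(w) (`exists_unnested`).

The complexity does not grow: bounded universal quantifiers are absorbed by Π̂ᵢ for i > 0, and
conjunction, as well as disjunction with the sharply bounded guard, preserve Π̂ᵢ. This is why (A) is
carried along as a conjunct instead of being the hypothesis of an implication. IND and PIND differ
only in the clock and the stages, recorded in `InductionScheme`. -/

namespace BoundedArithmetic

open FirstOrder.Language

/-! ### Arithmetic in models of the base theory -/

section Operations

variable {M : Type} [LTC.Structure M]

/-- The interpretation of a function symbol. -/
def fn {n : ℕ} (f : TCFunc n) (xs : Fin n → M) : M := Structure.funMap (L := LTC) f xs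

/-- The interpretation of `≤`. -/
def Le (x y : M) : Prop := Structure.RelMap (L := LTC) TCRel.le ![x, y]

variable (M) in
def zr : M := fn .zero ![]
def sc (x : M) : M := fn .succ ![x]
def hf (x : M) : M := fn .half ![x]
def ln (x : M) : M := fn .len ![x]
def ad (x y : M) : M := fn .add ![x, y]
def ml (x y : M) : M := fn .mul ![x, y]
def sm (x y : M) : M := fn .smash ![x, y]
def mo (x y : M) : M := fn .monus ![x, y]
def ms (x y : M) : M := fn .msp ![x, y]
def db (x : M) : M := ml (sc (sc (zr M))) x

variable {α : Type} (w : α → M) (s t : LTC.Term α)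

/-! ### Evaluation of terms and universal closures -/

theorem realize_app {n : ℕ} (f : TCFunc n) (ts : Fin n → LTC.Term α) :
    (app f ts).realize w = fn f fun i => (ts i).realize w := rfl

theorem realize_vec₀ : (fun i => ((![] : Fin 0 → LTC.Term α) i).realize w) = ![] :=
  funext fun i => i.elim0

theorem realize_vec₁ : (fun i => ((![s] : Fin 1 → LTC.Term α) i).realize w) = ![s.realize w] :=
  funext fun i => by fin_cases i; rfl

theorem realize_vec₂ : (fun i => ((![s, t] : Fin 2 → LTC.Term α) i).realize w) =
    ![s.realize w, t.realize w] :=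
  funext fun i => by fin_cases i <;> rfl

@[simp] theorem realize_tZero : (tZero : LTC.Term α).realize w = zr M := by
  rw [tZero, realize_app, realize_vec₀]; rfl
@[simp] theorem realize_tSucc : (tSucc s).realize w = sc (s.realize w) := by
  rw [tSucc, realize_app, realize_vec₁]; rfl
@[simp] theorem realize_tHalf : (tHalf s).realize w = hf (s.realize w) := by
  rw [tHalf, realize_app, realize_vec₁]; rfl
@[simp] theorem realize_tLen : (tLen s).realize w = ln (s.realize w) := by
  rw [tLen, realize_app, realize_vec₁]; rfl
@[simp] theorem realize_tAdd : (tAdd s t).realize w = ad (s.realize w) (t.realize w) := by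
  rw [tAdd, realize_app, realize_vec₂]; rfl
@[simp] theorem realize_tMul : (tMul s t).realize w = ml (s.realize w) (t.realize w) := by
  rw [tMul, realize_app, realize_vec₂]; rfl
@[simp] theorem realize_tSmash : (tSmash s t).realize w = sm (s.realize w) (t.realize w) := by
  rw [tSmash, realize_app, realize_vec₂]; rfl
@[simp] theorem realize_tMonus : (tMonus s t).realize w = mo (s.realize w) (t.realize w) := by
  rw [tMonus, realize_app, realize_vec₂]; rfl
@[simp] theorem realize_tMsp : (tMsp s t).realize w = ms (s.realize w) (t.realize w) := by
  rw [tMsp, realize_app, realize_vec₂]; rfl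
@[simp] theorem realize_tOne : (tOne : LTC.Term α).realize w = sc (zr M) := by simp [tOne]
@[simp] theorem realize_tDbl : (tDbl s).realize w = db (s.realize w) := by simp [tDbl, db]

@[simp] theorem realize_leF {k : ℕ} (s t : LTC.Term (α ⊕ Fin k)) (xs : Fin k → M) :
    (leF s t).Realize w xs ↔ Le (s.realize (Sum.elim w xs)) (t.realize (Sum.elim w xs)) := by
  have : (fun i => ((![s, t] : Fin 2 → LTC.Term (α ⊕ Fin k)) i).realize (Sum.elim w xs)) =
      ![s.realize (Sum.elim w xs), t.realize (Sum.elim w xs)] := realize_vec₂ _ _ _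
  rw [Le, ← this]; rfl

@[simp] theorem realize_v {n : ℕ} (j : Fin n) (w : Fin n → M) (xs : Fin 0 → M) :
    (v j).realize (Sum.elim w xs) = w j := rfl

@[simp] theorem realize_eqF {n : ℕ} (s t : LTC.Term (Fin n ⊕ Fin 0)) (w : Fin n → M)
    (xs : Fin 0 → M) : BoundedFormula.Realize (eqF s t) w xs ↔
      s.realize (Sum.elim w xs) = t.realize (Sum.elim w xs) := Iff.rfl

@[simp] theorem realize_hd {n k : ℕ} (j : Fin k) (ys : Fin k → M) (w : Fin n → M) (xs : Fin 0 → M) :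
    (hd j).realize (Sum.elim (Fin.append ys w) xs) = ys j := by simp [hd]

@[simp] theorem realize_appPar {n k : ℕ} (f : TCFunc (n + 1))
    (s : LTC.Term (Fin (k + n) ⊕ Fin 0)) (ys : Fin k → M) (w : Fin n → M) (xs : Fin 0 → M) :
    (appPar f s).realize (Sum.elim (Fin.append ys w) xs) =
      fn f (Fin.cons (s.realize (Sum.elim (Fin.append ys w) xs)) w) := by
  rw [appPar, realize_app]
  congr 1
  funext i
  refine Fin.cases rfl (fun i => ?_) i
  simp

theorem realize_univClosure {n : ℕ} (φ : LTC.Formula (Fin n)) :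
    M ⊨ univClosure φ ↔ ∀ w : Fin n → M, φ.Realize w := by
  rw [univClosure, Sentence.Realize, BoundedFormula.realize_alls]
  exact forall_congr' fun w => Formula.realize_relabel_sumInr φ

end Operations

/-! ### Elementary consequences of the axioms -/

section Arithmetic

variable {M : Type} [LTC.Structure M] [M ⊨ BTC]

theorem BTCAxiom.realize {n : ℕ} {φ : LTC.Formula (Fin n)} (h : BTCAxiom n φ) (w : Fin n → M) :
    φ.Realize w :=
  (realize_univClosure φ).1 (Theory.realize_sentence_of_mem BTC ⟨n, φ, h, rfl⟩) w

theorem Le.total (x y : M) : Le x y ∨ Le y x := by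
  simpa [Formula.Realize] using BTCAxiom.le_total.realize ![x, y]

theorem Le.refl (x : M) : Le x x := (Le.total x x).elim id id

theorem Le.trans {x y z : M} (h : Le x y) (h' : Le y z) : Le x z := by
  have := BTCAxiom.le_trans.realize ![x, y, z]
  simp [Formula.Realize] at this
  exact this h h'

theorem Le.antisymm {x y : M} (h : Le x y) (h' : Le y x) : x = y := by
  have := BTCAxiom.le_antisymm.realize ![x, y]
  simp [Formula.Realize] at this
  exact this h h'

theorem zr_le (x : M) : Le (zr M) x := by
  simpa [Formula.Realize] using BTCAxiom.zero_le.realize ![x]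

theorem Le.eq_zr {x : M} (h : Le x (zr M)) : x = zr M := h.antisymm (zr_le x)

theorem sc_le_iff {x y : M} : Le (sc x) y ↔ Le x y ∧ x ≠ y := by
  have := BTCAxiom.succ_le.realize ![x, y]
  simp [Formula.Realize] at this
  exact this.symm

theorem Le.le_sc {x y : M} (h : Le x y) : Le x (sc y) := by
  have := BTCAxiom.le_succ.realize ![y, x]
  simp [Formula.Realize] at this
  exact this h

theorem not_sc_le_self (x : M) : ¬ Le (sc x) x := fun h => (sc_le_iff.1 h).2 rfl

theorem sc_le_of_not_le {x y : M} (h : ¬ Le y x) : Le (sc x) y :=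
  sc_le_iff.2 ⟨(Le.total x y).resolve_right h, fun e => h (e ▸ Le.refl x)⟩

theorem le_self_sc (x : M) : Le x (sc x) := (Le.refl x).le_sc

theorem Le.sc {x y : M} (h : Le x y) : Le (sc x) (sc y) :=
  sc_le_iff.2 ⟨h.le_sc, fun e => not_sc_le_self y (e ▸ h)⟩

theorem not_sc_le {x y : M} (h : Le x y) : ¬ Le (BoundedArithmetic.sc y) x :=
  fun h' => not_sc_le_self y (h'.trans h)

theorem ad_comm (x y : M) : ad x y = ad y x := by
  simpa [Formula.Realize] using BTCAxiom.add_comm.realize ![x, y]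

theorem ad_zr (x : M) : ad x (zr M) = x := by
  simpa [Formula.Realize] using BTCAxiom.add_zero.realize ![x]

theorem ad_sc (x y : M) : ad x (sc y) = sc (ad x y) := by
  simpa [Formula.Realize] using BTCAxiom.add_succ.realize ![x, y]

theorem sc_ad (x y : M) : ad (sc x) y = sc (ad x y) := by
  rw [ad_comm, ad_sc, ad_comm]

theorem ad_le_ad_left_iff {x y z : M} : Le (ad x y) (ad x z) ↔ Le y z := by
  simpa [Formula.Realize] using BTCAxiom.add_le_add.realize ![x, y, z]

theorem le_ad (x y : M) : Le x (ad x y) := by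
  simpa [Formula.Realize] using BTCAxiom.le_add.realize ![x, y]

theorem le_ad' (x y : M) : Le y (ad x y) := ad_comm y x ▸ le_ad y x

theorem ad_left_cancel {x y z : M} (h : ad x y = ad x z) : y = z :=
  ((ad_le_ad_left_iff (x := x)).1 (by rw [h]; exact Le.refl _)).antisymm
    ((ad_le_ad_left_iff (x := x)).1 (by rw [h]; exact Le.refl _))

theorem ad_right_cancel {x y z : M} (h : ad y x = ad z x) : y = z :=
  ad_left_cancel (x := x) (by rw [ad_comm, h, ad_comm])

theorem Le.ad {x x' y y' : M} (hx : Le x x') (hy : Le y y') : Le (ad x y) (ad x' y') :=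
  (ad_le_ad_left_iff.2 hy).trans (by
    rw [ad_comm, ad_comm x']; exact ad_le_ad_left_iff.2 hx)

theorem ml_zr (x : M) : ml x (zr M) = zr M := by
  simpa [Formula.Realize] using BTCAxiom.mul_zero.realize ![x]

theorem ml_sc (x y : M) : ml x (sc y) = ad (ml x y) x := by
  simpa [Formula.Realize] using BTCAxiom.mul_succ.realize ![x, y]

theorem ml_comm (x y : M) : ml x y = ml y x := by
  simpa [Formula.Realize] using BTCAxiom.mul_comm.realize ![x, y]

theorem zr_ml (x : M) : ml (zr M) x = zr M := by rw [ml_comm, ml_zr]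

theorem eq_zr_or_one_le (x : M) : x = zr M ∨ Le (sc (zr M)) x := by
  by_cases h : x = zr M
  · exact Or.inl h
  · exact Or.inr (sc_le_iff.2 ⟨zr_le x, Ne.symm h⟩)

theorem ml_le_ml_left {x y z : M} (h : Le y z) : Le (ml x y) (ml x z) := by
  rcases eq_zr_or_one_le x with rfl | hx
  · rw [zr_ml, zr_ml]; exact Le.refl _
  · have := BTCAxiom.mul_le_mul.realize ![x, y, z]
    simp [Formula.Realize] at this
    exact (this hx).2 h

theorem Le.ml {x x' y y' : M} (hx : Le x x') (hy : Le y y') : Le (ml x y) (ml x' y') :=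
  (ml_le_ml_left hy).trans (by rw [ml_comm, ml_comm x']; exact ml_le_ml_left hx)

theorem db_eq (x : M) : db x = ad x x := by
  rw [db, ml_comm, ml_sc, ml_sc, ml_zr, ad_comm (zr M), ad_zr]

theorem db_zr : db (zr M) = zr M := by rw [db_eq, ad_zr]

theorem eq_hf_iff {x y : M} : x = hf y ↔ db x = y ∨ sc (db x) = y := by
  simpa [Formula.Realize] using BTCAxiom.half_iff.realize ![x, y]

theorem hf_le (x : M) : Le (hf x) x := by
  have h : Le (hf x) (db (hf x)) := by rw [db_eq]; exact le_ad _ _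
  rcases eq_hf_iff.1 (rfl : hf x = hf x) with e | e
  · rwa [e] at h
  · have := h.le_sc
    rwa [e] at this

theorem hf_zr : hf (zr M) = zr M := (hf_le _).eq_zr

theorem ln_zr : ln (zr M) = zr M := by
  have := BTCAxiom.len_zero.realize (M := M) ![]
  simpa [Formula.Realize] using this

theorem ln_one : ln (sc (zr M)) = sc (zr M) := by
  have := BTCAxiom.len_one.realize (M := M) ![]
  simpa [Formula.Realize] using this

theorem Le.ln {x y : M} (h : Le x y) : Le (ln x) (ln y) := by
  have := BTCAxiom.len_mono.realize ![x, y]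
  simp [Formula.Realize] at this
  exact this h

theorem ln_eq_sc_ln_hf {x : M} (h : x ≠ zr M) : ln x = sc (ln (hf x)) := by
  have := BTCAxiom.len_half.realize ![x]
  simp [Formula.Realize] at this
  exact this h

theorem ln_sc_db (x : M) : ln (sc (db x)) = sc (ln x) := by
  by_cases h : x = zr M
  · rw [h, db_zr, ln_one, ln_zr]
  · have := BTCAxiom.len_dbl.realize ![x]
    simp [Formula.Realize] at this
    exact (this h).2

/-- Otherwise 2y + 1 ≤ x, and the length of 2y + 1 is |y| + 1. This converts bounds on lengths into
bounds on values, as needed for `smash`. -/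
theorem le_sc_db_of_ln_le {x y : M} (h : Le (ln x) (ln y)) : Le x (sc (db y)) := by
  refine (Le.total _ _).resolve_right fun h' => ?_
  have := h'.ln
  rw [ln_sc_db] at this
  exact not_sc_le h this

theorem ln_sm (x y : M) : ln (sm x y) = sc (ml (ln x) (ln y)) := by
  simpa [Formula.Realize] using BTCAxiom.len_smash.realize ![x, y]

theorem Le.ln_sm {x x' y y' : M} (hx : Le x x') (hy : Le y y') :
    Le (BoundedArithmetic.ln (sm x y)) (BoundedArithmetic.ln (sm x' y')) := by
  rw [BoundedArithmetic.ln_sm, BoundedArithmetic.ln_sm]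
  exact (hx.ln.ml hy.ln).sc

theorem mo_ad {x y : M} (h : Le y x) : ad (mo x y) y = x := by
  have := BTCAxiom.monus_add.realize ![x, y]
  simp [Formula.Realize] at this
  exact this h

theorem mo_eq_zr {x y : M} (h : Le x y) : mo x y = zr M := by
  have := BTCAxiom.monus_zero.realize ![x, y]
  simp [Formula.Realize] at this
  exact this h

theorem mo_zr (x : M) : mo x (zr M) = x := by
  rw [← ad_zr (mo x (zr M)), mo_ad (zr_le x)]

theorem mo_le (x y : M) : Le (mo x y) x := by
  rcases Le.total x y with h | h
  · rw [mo_eq_zr h]; exact zr_le x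
  · have := le_ad (mo x y) y
    rwa [mo_ad h] at this

theorem le_of_mo_eq_zr {x y : M} (h : mo x y = zr M) : Le x y := by
  rcases Le.total x y with h' | h'
  · exact h'
  · have := mo_ad h'
    rw [h, ad_comm, ad_zr] at this
    exact this ▸ Le.refl y

theorem sc_mo {x y : M} (h : Le y x) : mo (sc x) y = sc (mo x y) :=
  ad_right_cancel (x := y) (by rw [mo_ad h.le_sc, sc_ad, mo_ad h])

theorem mo_eq_sc_mo_sc {x y : M} (h : Le (sc y) x) : mo x y = sc (mo x (sc y)) :=
  ad_right_cancel (x := y) (by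
    rw [mo_ad ((le_self_sc y).trans h), sc_ad, ← ad_sc, mo_ad h])

theorem mo_mo {x y : M} (h : Le y x) : mo x (mo x y) = y :=
  ad_right_cancel (x := mo x y) (by rw [mo_ad (mo_le x y), ad_comm, mo_ad h])

theorem ms_zr (x : M) : ms x (zr M) = x := by
  simpa [Formula.Realize] using BTCAxiom.msp_zero.realize ![x]

theorem ms_sc (x y : M) : ms x (sc y) = hf (ms x y) := by
  simpa [Formula.Realize] using BTCAxiom.msp_succ.realize ![x, y]

theorem ms_eq_zr {x y : M} (h : Le (ln x) y) : ms x y = zr M := by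
  have := BTCAxiom.msp_large.realize ![x, y]
  simp [Formula.Realize] at this
  exact this h

theorem fn_proj {n : ℕ} (j : Fin n) (xs : Fin n → M) : fn (.proj j) xs = xs j :=
  (BTCAxiom.proj j).realize xs

theorem fn_comp {k n : ℕ} (f : TCFunc k) (g : Fin k → TCFunc n) (xs : Fin n → M) :
    fn (.comp f g) xs = fn f fun j => fn (g j) xs :=
  (BTCAxiom.comp f g).realize xs

theorem search_le {n : ℕ} (f : TCFunc (n + 1)) (z : M) (xs : Fin n → M) :
    Le (fn (.search f) (Fin.cons z xs)) (ln z) := by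
  simpa [Formula.Realize] using (BTCAxiom.search_le f).realize (Fin.append ![z] xs)

theorem search_spec {n : ℕ} (f : TCFunc (n + 1)) {z : M} {xs : Fin n → M}
    (h : fn (.search f) (Fin.cons z xs) ≠ ln z) :
    fn f (Fin.cons (fn (.search f) (Fin.cons z xs)) xs) ≠ zr M := by
  have := (BTCAxiom.search_spec f).realize (Fin.append ![z] xs)
  simp [Formula.Realize] at this
  exact this h

theorem search_min {n : ℕ} (f : TCFunc (n + 1)) {z i : M} {xs : Fin n → M}
    (h : Le (sc i) (fn (.search f) (Fin.cons z xs))) : fn f (Fin.cons i xs) = zr M := by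
  have := (BTCAxiom.search_min f).realize (Fin.append ![z, i] xs)
  simp [Formula.Realize] at this
  exact this h

theorem compr_lt {n : ℕ} (f : TCFunc (n + 1)) (z : M) (xs : Fin n → M) :
    Le (sc (fn (.compr f) (Fin.cons z xs))) (sm (sc (zr M)) z) := by
  simpa [Formula.Realize] using (BTCAxiom.compr_lt f).realize (Fin.append ![z] xs)

theorem count_le {n : ℕ} (f : TCFunc (n + 1)) (z : M) (xs : Fin n → M) :
    Le (fn (.count f) (Fin.cons z xs)) (ln z) := by
  simpa [Formula.Realize] using (BTCAxiom.count_le f).realize (Fin.append ![z] xs)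

theorem eq_sc_of_ne_zr {x : M} (h : x ≠ zr M) : ∃ y, x = sc y :=
  ⟨mo x (sc (zr M)), by
    have := mo_ad (sc_le_iff.2 ⟨zr_le x, Ne.symm h⟩)
    rwa [ad_sc, ad_zr, eq_comm] at this⟩

/-- An induction on i is needed, and sharply bounded minimization supplies it: search for the least
j < |x| with `MSP(x, j) ∸ x` nonzero. Such a j cannot be 0, and cannot be a successor because
halving does not increase a value. -/
theorem ms_le (x i : M) : Le (ms x i) x := by
  let f : TCFunc 2 := .comp .monus ![.comp .msp ![.proj 1, .proj 0], .proj 1]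
  have hf' : ∀ j : M, fn f (Fin.cons j ![x]) = mo (ms x j) x := fun j => by
    simp only [f, fn_comp]
    rw [mo, ms]
    congr 1
    funext k
    fin_cases k
    · simp only [Fin.zero_eta, Matrix.cons_val_zero, fn_comp]
      congr 1
      funext l
      fin_cases l <;> simp [fn_proj]
    · simp [fn_proj]
  have key : fn (.search f) (Fin.cons x ![x]) = ln x := by
    by_contra h
    have h1 := search_spec f h
    rw [hf'] at h1
    refine h1 (mo_eq_zr ?_)
    by_cases h0 : fn (.search f) (Fin.cons x ![x]) = zr M
    · rw [h0, ms_zr]; exact Le.refl x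
    · obtain ⟨j, hj⟩ := eq_sc_of_ne_zr h0
      have h2 := search_min f (i := j) (by rw [hj]; exact Le.refl (sc j))
      rw [hf'] at h2
      rw [hj, ms_sc]
      exact (hf_le _).trans (le_of_mo_eq_zr h2)
  -- The search covers only i < |x|; beyond that `MSP(x, i)` vanishes.
  by_cases h : Le (ln x) i
  · rw [ms_eq_zr h]; exact zr_le x
  · have h2 := search_min f (key ▸ sc_le_of_not_le h)
    rw [hf'] at h2
    exact le_of_mo_eq_zr h2

end Arithmetic

/-! ### Closure properties of classes of formulas -/

section Classes

variable {α β : Type}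

@[simp] theorem realize_boundF {M : Type} [LTC.Structure M] {k : ℕ} (t : LTC.Term (α ⊕ Fin k))
    (w : α → M) (xs : Fin k → M) (a : M) :
    (boundF t).Realize w (Fin.snoc xs a) ↔ Le a (t.realize (Sum.elim w xs)) := by
  have : Sum.elim w (Fin.snoc xs a : Fin (k + 1) → M) ∘ Sum.map id Fin.castSucc =
      Sum.elim w xs := by
    funext x
    rcases x with x | x <;> simp
  simp [boundF, this]

@[simp] theorem realize_ballF {M : Type} [LTC.Structure M] {k : ℕ} (t : LTC.Term (α ⊕ Fin k))
    (φ : LTC.BoundedFormula α (k + 1)) (w : α → M) (xs : Fin k → M) :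
    (ballF t φ).Realize w xs ↔
      ∀ a : M, Le a (t.realize (Sum.elim w xs)) → φ.Realize w (Fin.snoc xs a) := by
  simp [ballF]

@[simp] theorem realize_bexF {M : Type} [LTC.Structure M] {k : ℕ} (t : LTC.Term (α ⊕ Fin k))
    (φ : LTC.BoundedFormula α (k + 1)) (w : α → M) (xs : Fin k → M) :
    (bexF t φ).Realize w xs ↔
      ∃ a : M, Le a (t.realize (Sum.elim w xs)) ∧ φ.Realize w (Fin.snoc xs a) := by
  simp [bexF]

/-- Extend a simultaneous substitution to one more bound variable, which is left fixed. -/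
def liftSubst {k m : ℕ} (σ : α ⊕ Fin k → LTC.Term (β ⊕ Fin m)) :
    α ⊕ Fin (k + 1) → LTC.Term (β ⊕ Fin (m + 1)) :=
  Sum.elim (fun a => (σ (.inl a)).relabel (Sum.map id Fin.castSucc))
    (Fin.snoc (fun j => (σ (.inr j)).relabel (Sum.map id Fin.castSucc))
      (Term.var (.inr (Fin.last m))))

/-- The formula `ψ` is obtained from `φ` by the simultaneous substitution `σ`, up to logical
equivalence. -/
def IsSubst {k m : ℕ} (φ : LTC.BoundedFormula α k) (σ : α ⊕ Fin k → LTC.Term (β ⊕ Fin m))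
    (ψ : LTC.BoundedFormula β m) : Prop :=
  ∀ (M : Type) [LTC.Structure M] (w : β → M) (xs : Fin m → M), ψ.Realize w xs ↔
    φ.Realize (fun a => (σ (.inl a)).realize (Sum.elim w xs))
      (fun j => (σ (.inr j)).realize (Sum.elim w xs))

/-! ### Substitution within the classes of formulas -/

theorem realize_subst_sum {M : Type} [LTC.Structure M] {k m : ℕ}
    (σ : α ⊕ Fin k → LTC.Term (β ⊕ Fin m)) (t : LTC.Term (α ⊕ Fin k)) (w : β → M)
    (xs : Fin m → M) : (t.subst σ).realize (Sum.elim w xs) =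
      t.realize (Sum.elim (fun a => (σ (.inl a)).realize (Sum.elim w xs))
        (fun j => (σ (.inr j)).realize (Sum.elim w xs))) := by
  rw [Term.realize_subst]
  congr 1
  funext x
  rcases x with x | x <;> rfl

theorem IsSubst.realize_snoc {M : Type} [LTC.Structure M] {k m : ℕ}
    {φ : LTC.BoundedFormula α (k + 1)} {σ : α ⊕ Fin k → LTC.Term (β ⊕ Fin m)}
    {ψ : LTC.BoundedFormula β (m + 1)} (h : IsSubst φ (liftSubst σ) ψ) (w : β → M)
    (xs : Fin m → M) (a : M) : ψ.Realize w (Fin.snoc xs a) ↔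
      φ.Realize (fun a => (σ (.inl a)).realize (Sum.elim w xs))
        (Fin.snoc (fun j => (σ (.inr j)).realize (Sum.elim w xs)) a) := by
  have e : Sum.elim w (Fin.snoc xs a : Fin (m + 1) → M) ∘ Sum.map id Fin.castSucc =
      Sum.elim w xs := by
    funext x
    rcases x with x | x <;> simp
  rw [h M w]
  refine iff_of_eq (congr (congrArg _ (funext fun x => ?_)) (funext fun j => ?_))
  · simp [liftSubst, e]
  · refine Fin.lastCases ?_ (fun j => ?_) j
    · simp [liftSubst]
    · simp [liftSubst, e]

theorem IsSubst.ballF {k m : ℕ} {φ : LTC.BoundedFormula α (k + 1)}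
    {σ : α ⊕ Fin k → LTC.Term (β ⊕ Fin m)} {ψ : LTC.BoundedFormula β (m + 1)}
    (h : IsSubst φ (liftSubst σ) ψ) (t : LTC.Term (α ⊕ Fin k)) :
    IsSubst (BoundedArithmetic.ballF t φ) σ (BoundedArithmetic.ballF (t.subst σ) ψ) := by
  intro M _ w xs
  simp only [realize_ballF, h.realize_snoc, realize_subst_sum]

theorem IsSubst.bexF {k m : ℕ} {φ : LTC.BoundedFormula α (k + 1)}
    {σ : α ⊕ Fin k → LTC.Term (β ⊕ Fin m)} {ψ : LTC.BoundedFormula β (m + 1)}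
    (h : IsSubst φ (liftSubst σ) ψ) (t : LTC.Term (α ⊕ Fin k)) :
    IsSubst (BoundedArithmetic.bexF t φ) σ (BoundedArithmetic.bexF (t.subst σ) ψ) := by
  intro M _ w xs
  simp only [realize_bexF, h.realize_snoc, realize_subst_sum]

theorem tLen_subst (t : LTC.Term α) (σ : α → LTC.Term β) :
    tLen (t.subst σ) = (tLen t).subst σ :=
  congrArg (app TCFunc.len) (funext fun i => by fin_cases i; rfl)

/-- The class is syntactic, so ψ is built along the derivation that φ belongs to it. Bounds keep the
form |s| because substitution commutes with `tLen`. -/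
theorem IsSharplyBounded.exists_subst {k : ℕ} {φ : LTC.BoundedFormula α k}
    (h : IsSharplyBounded φ) : ∀ {m : ℕ} (σ : α ⊕ Fin k → LTC.Term (β ⊕ Fin m)),
      ∃ ψ, IsSharplyBounded ψ ∧ IsSubst φ σ ψ := by
  induction h with
  | falsum => exact fun σ => ⟨⊥, .falsum, fun M _ w xs => Iff.rfl⟩
  | eq s t =>
    refine fun σ => ⟨_, .eq (s.subst σ) (t.subst σ), fun M _ w xs => ?_⟩
    simp only [BoundedFormula.realize_bdEqual, realize_subst_sum]
  | le s t =>
    refine fun σ => ⟨_, .le (s.subst σ) (t.subst σ), fun M _ w xs => ?_⟩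
    simp only [realize_leF, realize_subst_sum]
  | imp _ _ ih₁ ih₂ =>
    intro m σ
    obtain ⟨ψ₁, h₁, e₁⟩ := ih₁ σ
    obtain ⟨ψ₂, h₂, e₂⟩ := ih₂ σ
    refine ⟨_, .imp h₁ h₂, fun M _ w xs => ?_⟩
    rw [BoundedFormula.realize_imp, BoundedFormula.realize_imp, e₁ M, e₂ M]
  | ball t _ ih =>
    intro m σ
    obtain ⟨ψ, h, e⟩ := ih (liftSubst σ)
    exact ⟨_, .ball (t.subst σ) h, tLen_subst t σ ▸ e.ballF (tLen t)⟩
  | bex t _ ih =>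
    intro m σ
    obtain ⟨ψ, h, e⟩ := ih (liftSubst σ)
    exact ⟨_, .bex (t.subst σ) h, tLen_subst t σ ▸ e.bexF (tLen t)⟩

theorem IsStrict.exists_subst {c : Kind} {i k : ℕ} {φ : LTC.BoundedFormula α k}
    (h : IsStrict c i φ) : ∀ {m : ℕ} (σ : α ⊕ Fin k → LTC.Term (β ⊕ Fin m)),
      ∃ ψ, IsStrict c i ψ ∧ IsSubst φ σ ψ := by
  induction h with
  | sharp h =>
    intro m σ
    obtain ⟨ψ, h, e⟩ := h.exists_subst σ
    exact ⟨ψ, .sharp h, e⟩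
  | sigma _ ih =>
    intro m σ
    obtain ⟨ψ, h, e⟩ := ih σ
    exact ⟨ψ, .sigma h, e⟩
  | pi _ ih =>
    intro m σ
    obtain ⟨ψ, h, e⟩ := ih σ
    exact ⟨ψ, .pi h, e⟩
  | bex t _ ih =>
    intro m σ
    obtain ⟨ψ, h, e⟩ := ih (liftSubst σ)
    exact ⟨_, .bex (t.subst σ) h, e.bexF t⟩
  | ball t _ ih =>
    intro m σ
    obtain ⟨ψ, h, e⟩ := ih (liftSubst σ)
    exact ⟨_, .ball (t.subst σ) h, e.ballF t⟩

/-- A dummy bound variable lets a formula slide under a quantifier of another formula when prefixes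
are merged. -/
theorem IsStrict.exists_weaken {c : Kind} {i k : ℕ} {φ : LTC.BoundedFormula α k}
    (h : IsStrict c i φ) : ∃ ψ : LTC.BoundedFormula α (k + 1), IsStrict c i ψ ∧
      ∀ (M : Type) [LTC.Structure M] (w : α → M) (xs : Fin k → M) (a : M),
        ψ.Realize w (Fin.snoc xs a) ↔ φ.Realize w xs := by
  obtain ⟨ψ, h, e⟩ := h.exists_subst (fun x => Term.var (Sum.map id Fin.castSucc x))
  refine ⟨ψ, h, fun M _ w xs a => (e M _ _).trans (iff_of_eq ?_)⟩
  congr 1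
  funext j
  simp

theorem IsSharplyBounded.isStrict {k : ℕ} {φ : LTC.BoundedFormula α k}
    (h : IsSharplyBounded φ) (c : Kind) (i : ℕ) : IsStrict c i φ := by
  induction i generalizing c with
  | zero => exact .sharp h
  | succ i ih =>
    cases c with
    | sigma => exact .sigma (ih _)
    | pi => exact .pi (ih _)

theorem IsSharplyBounded.isBounded {k : ℕ} {φ : LTC.BoundedFormula α k}
    (h : IsSharplyBounded φ) : IsBounded φ := by
  induction h with
  | falsum => exact .falsum
  | eq s t => exact .eq s t
  | le s t => exact .le s t
  | imp _ _ h₁ h₂ => exact .imp h₁ h₂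
  | ball t _ h => exact .ball _ h
  | bex t _ h => exact .bex _ h

theorem IsStrict.isBounded {c : Kind} {i k : ℕ} {φ : LTC.BoundedFormula α k}
    (h : IsStrict c i φ) : IsBounded φ := by
  induction h with
  | sharp h => exact h.isBounded
  | sigma _ h => exact h
  | pi _ h => exact h
  | ball t _ h => exact .ball _ h
  | bex t _ h => exact .bex _ h

theorem IsBounded.not {k : ℕ} {φ : LTC.BoundedFormula α k} (h : IsBounded φ) : IsBounded φ.not :=
  .imp h .falsum

theorem IsBounded.inf {k : ℕ} {φ ψ : LTC.BoundedFormula α k} (h : IsBounded φ)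
    (h' : IsBounded ψ) : IsBounded (φ ⊓ ψ) :=
  (h.imp h'.not).not

theorem IsBounded.sup {k : ℕ} {φ ψ : LTC.BoundedFormula α k} (h : IsBounded φ)
    (h' : IsBounded ψ) : IsBounded (φ ⊔ ψ) :=
  h.not.imp h'

theorem IsBounded.iff {k : ℕ} {φ ψ : LTC.BoundedFormula α k} (h : IsBounded φ)
    (h' : IsBounded ψ) : IsBounded (φ.iff ψ) :=
  (h.imp h').inf (h'.imp h)

/-- A binary connective that commutes with quantifiers over nonempty domains. -/
structure Positive (op : Prop → Prop → Prop) : Prop where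
  comm : ∀ p q, op p q ↔ op q p
  -- Nonemptiness of the range matters for ∧ under a universal quantifier and for ∨ under an
  -- existential one.
  all : ∀ {ι : Type} (s p : ι → Prop) (q : Prop), (∃ i, s i) →
    (op (∀ i, s i → p i) q ↔ ∀ i, s i → op (p i) q)
  ex : ∀ {ι : Type} (s p : ι → Prop) (q : Prop), (∃ i, s i) →
    (op (∃ i, s i ∧ p i) q ↔ ∃ i, s i ∧ op (p i) q)
  sharp : ∀ {k : ℕ} {φ ψ : LTC.BoundedFormula α k}, IsSharplyBounded φ → IsSharplyBounded ψ →
    ∃ θ : LTC.BoundedFormula α k, IsSharplyBounded θ ∧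
      ∀ (M : Type) [LTC.Structure M] [M ⊨ BTC] (w : α → M) (xs : Fin k → M),
        θ.Realize w xs ↔ op (φ.Realize w xs) (ψ.Realize w xs)

theorem positive_and : Positive (α := α) And where
  comm _ _ := and_comm
  all _ _ _ := fun ⟨i, hi⟩ =>
    ⟨fun h j hj => ⟨h.1 j hj, h.2⟩, fun h => ⟨fun j hj => (h j hj).1, (h i hi).2⟩⟩
  ex _ _ _ _ := ⟨fun ⟨⟨i, hi, hp⟩, hq⟩ => ⟨i, hi, hp, hq⟩, fun ⟨i, hi, hp, hq⟩ => ⟨⟨i, hi, hp⟩, hq⟩⟩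
  sharp {_ φ ψ} h h' := ⟨φ ⊓ ψ, (h.imp (h'.imp .falsum)).imp .falsum,
    fun _ _ _ _ _ => BoundedFormula.realize_inf⟩

theorem positive_or : Positive (α := α) Or where
  comm _ _ := or_comm
  all _ _ q := fun ⟨i, hi⟩ => by
    by_cases hq : q <;> simp [hq]
  ex _ _ q := fun ⟨i, hi⟩ => by
    by_cases hq : q
    · simpa [hq] using ⟨i, hi⟩
    · simp [hq]
  sharp {_ φ ψ} h h' := ⟨φ ⊔ ψ, (h.imp .falsum).imp h',
    fun _ _ _ _ _ => BoundedFormula.realize_sup⟩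

/-- `θ` is equivalent, over the base theory, to the combination of `φ` and `ψ` by `op`. -/
def IsOp (op : Prop → Prop → Prop) {k : ℕ} (φ ψ θ : LTC.BoundedFormula α k) : Prop :=
  ∀ (M : Type) [LTC.Structure M] [M ⊨ BTC] (w : α → M) (xs : Fin k → M),
    θ.Realize w xs ↔ op (φ.Realize w xs) (ψ.Realize w xs)

theorem IsOp.symm {op : Prop → Prop → Prop} (hop : Positive (α := α) op) {k : ℕ}
    {φ ψ θ : LTC.BoundedFormula α k} (h : IsOp op φ ψ θ) : IsOp op ψ φ θ :=
  fun M _ _ w xs => (h M w xs).trans (hop.comm _ _)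

theorem IsOp.ballF {op : Prop → Prop → Prop} (hop : Positive (α := α) op) {k : ℕ}
    {φ ψ' θ : LTC.BoundedFormula α (k + 1)} {ψ : LTC.BoundedFormula α k} (h : IsOp op φ ψ' θ)
    (hψ : ∀ (M : Type) [LTC.Structure M] (w : α → M) (xs : Fin k → M) (a : M),
      ψ'.Realize w (Fin.snoc xs a) ↔ ψ.Realize w xs) (t : LTC.Term (α ⊕ Fin k)) :
    IsOp op (BoundedArithmetic.ballF t φ) ψ (BoundedArithmetic.ballF t θ) := by
  intro M _ _ w xs
  simp only [realize_ballF]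
  -- A bounded quantifier has nonempty range: the bound itself belongs to it.
  rw [hop.all (fun a => Le a _) (fun a => φ.Realize w (Fin.snoc xs a)) _ ⟨_, Le.refl _⟩]
  simp only [h M, hψ M]

theorem IsOp.bexF {op : Prop → Prop → Prop} (hop : Positive (α := α) op) {k : ℕ}
    {φ ψ' θ : LTC.BoundedFormula α (k + 1)} {ψ : LTC.BoundedFormula α k} (h : IsOp op φ ψ' θ)
    (hψ : ∀ (M : Type) [LTC.Structure M] (w : α → M) (xs : Fin k → M) (a : M),
      ψ'.Realize w (Fin.snoc xs a) ↔ ψ.Realize w xs) (t : LTC.Term (α ⊕ Fin k)) :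
    IsOp op (BoundedArithmetic.bexF t φ) ψ (BoundedArithmetic.bexF t θ) := by
  intro M _ _ w xs
  simp only [realize_bexF]
  rw [hop.ex (fun a => Le a _) (fun a => φ.Realize w (Fin.snoc xs a)) _ ⟨_, Le.refl _⟩]
  simp only [h M, hψ M]

/-- The class one alternation below, in the other kind. -/
def Kind.flip : Kind → Kind
  | .sigma => .pi
  | .pi => .sigma

theorem IsStrict.of_flip {c : Kind} {i k : ℕ} {φ : LTC.BoundedFormula α k}
    (h : IsStrict c.flip i φ) : IsStrict c (i + 1) φ := by
  cases c
  · exact .sigma h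
  · exact .pi h

/-- Pulling the quantifiers of the first block of `φ` out of `op φ ψ`. -/
theorem IsStrict.exists_op_of_flip {op : Prop → Prop → Prop} (hop : Positive (α := α) op)
    {P : {k : ℕ} → LTC.BoundedFormula α k → Prop}
    (hP : ∀ {k : ℕ} {ψ : LTC.BoundedFormula α k}, P ψ → ∃ ψ' : LTC.BoundedFormula α (k + 1),
      P ψ' ∧ ∀ (M : Type) [LTC.Structure M] (w : α → M) (xs : Fin k → M) (a : M),
        ψ'.Realize w (Fin.snoc xs a) ↔ ψ.Realize w xs) {c : Kind} {i : ℕ}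
    (H : ∀ {k : ℕ} {φ ψ : LTC.BoundedFormula α k}, IsStrict c.flip i φ → P ψ →
      ∃ θ, IsStrict c (i + 1) θ ∧ IsOp op φ ψ θ) {k : ℕ} {φ ψ : LTC.BoundedFormula α k}
    (hφ : IsStrict c (i + 1) φ) (hψ : P ψ) : ∃ θ, IsStrict c (i + 1) θ ∧ IsOp op φ ψ θ := by
  generalize hj : i + 1 = j at hφ
  induction hφ with
  | sharp _ => cases hj
  | sigma h _ => cases hj; exact H h hψ
  | pi h _ => cases hj; exact H h hψ
  | bex t _ ih =>
    obtain ⟨ψ', h, e⟩ := hP hψ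
    obtain ⟨θ, hθ, e'⟩ := ih H h hj
    cases hj
    exact ⟨_, .bex t hθ, e'.bexF hop e t⟩
  | ball t _ ih =>
    obtain ⟨ψ', h, e⟩ := hP hψ
    obtain ⟨θ, hθ, e'⟩ := ih H h hj
    cases hj
    exact ⟨_, .ball t hθ, e'.ballF hop e t⟩

/-- The leading blocks of φ and ψ have the same kind, so pulling out first the block of φ and then
that of ψ yields one block. What remains are two formulas of the opposite kind one level lower,
combined by induction. -/
theorem IsStrict.exists_op {op : Prop → Prop → Prop} (hop : Positive (α := α) op) {c : Kind}
    {i k : ℕ} {φ ψ : LTC.BoundedFormula α k} (hφ : IsStrict c i φ) (hψ : IsStrict c i ψ) :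
    ∃ θ, IsStrict c i θ ∧ IsOp op φ ψ θ := by
  induction i generalizing c k φ ψ with
  | zero =>
    cases hφ with
    | sharp h =>
      cases hψ with
      | sharp h' =>
        obtain ⟨θ, hθ, e⟩ := hop.sharp h h'
        exact ⟨θ, .sharp hθ, e⟩
  | succ i ih =>
    refine IsStrict.exists_op_of_flip hop (P := IsStrict c (i + 1)) exists_weaken ?_ hφ hψ
    intro k φ ψ hφ hψ
    obtain ⟨θ, hθ, e⟩ := IsStrict.exists_op_of_flip hop (P := IsStrict c.flip i) exists_weaken
      (fun h h' => (ih h h').imp fun θ hθ => ⟨hθ.1.of_flip, hθ.2⟩) hψ hφ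
    exact ⟨θ, hθ, e.symm hop⟩

theorem IsStrict.exists_forall_list {ι : Type*} {c : Kind} {i k : ℕ} (l : List ι)
    {φ : ι → LTC.BoundedFormula α k} (h : ∀ j ∈ l, IsStrict c i (φ j)) :
    ∃ θ, IsStrict c i θ ∧ ∀ (M : Type) [LTC.Structure M] [M ⊨ BTC] (w : α → M) (xs : Fin k → M),
      θ.Realize w xs ↔ ∀ j ∈ l, (φ j).Realize w xs := by
  induction l with
  | nil =>
    exact ⟨_, (IsSharplyBounded.falsum.imp .falsum).isStrict c i, fun M _ _ w xs => by simp⟩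
  | cons a l ih =>
    obtain ⟨θ, hθ, e⟩ := ih fun j hj => h j (List.mem_cons_of_mem _ hj)
    obtain ⟨θ', hθ', e'⟩ := (h a List.mem_cons_self).exists_op positive_and hθ
    exact ⟨θ', hθ', fun M _ _ w xs => by simp [e' M, e M]⟩

/-- Bounding all the bound variables universally by the same term. -/
theorem IsStrict.exists_balls {i k : ℕ} (t : LTC.Term α) {φ : LTC.BoundedFormula α k}
    (h : IsStrict .pi (i + 1) φ) : ∃ θ : LTC.Formula α, IsStrict .pi (i + 1) θ ∧
      ∀ (M : Type) [LTC.Structure M] (w : α → M), θ.Realize w ↔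
        ∀ xs : Fin k → M, (∀ j, Le (xs j) (t.realize w)) → φ.Realize w xs := by
  induction k with
  | zero =>
    refine ⟨φ, h, fun M _ w => ?_⟩
    rw [Unique.forall_iff, Formula.Realize]
    simp
  | succ k ih =>
    obtain ⟨θ, hθ, e⟩ := ih (h.ball (t.relabel Sum.inl))
    refine ⟨θ, hθ, fun M _ w => (e M w).trans ?_⟩
    simp only [realize_ballF, Term.realize_relabel, Sum.elim_comp_inl]
    constructor
    · intro H xs hxs
      have := H (Fin.init xs) (fun j => hxs _) (xs (Fin.last k)) (hxs _)
      rwa [Fin.snoc_init_self] at this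
    · intro H xs hxs a ha
      refine H _ fun j => ?_
      refine Fin.lastCases ?_ (fun j => ?_) j
      · simpa using ha
      · simpa using hxs j

end Classes

/-! ### Provability and models -/

/-- Completeness reduces to compactness, since all valid sentences are available: the finitely many
axioms used are moved into antecedents and discharged by modus ponens. Models are nonempty because
of the constant 0. -/
theorem provable_iff {Γ : LTC.Theory} {σ : LTC.Sentence} :
    Provable Γ σ ↔ ∀ (M : Type) [LTC.Structure M] [M ⊨ BTC] [M ⊨ Γ], M ⊨ σ := by
  constructor
  · intro h M _ _ _
    have : Nonempty M := ⟨zr M⟩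
    induction h with
    | base h => exact BTC.realize_sentence_of_mem h
    | hyp h => exact Γ.realize_sentence_of_mem h
    | valid h => exact Theory.ModelsBoundedFormula.realize_sentence h M
    | mp _ _ h₁ h₂ => exact (Sentence.realize_imp M).1 h₁ h₂
  · intro h
    have hc : BTC ∪ Γ ⊨ᵇ σ := Theory.models_sentence_iff.2 fun M => by
      obtain ⟨_, _⟩ := Theory.model_union_iff.1 M.is_model
      exact h M
    obtain ⟨S, hS, h'⟩ := Theory.models_iff_finset_models.1 hc
    clear h hc
    classical
    induction S using Finset.induction_on generalizing σ with
    | empty => exact .valid (by simpa using h')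
    | insert τ S _ ih =>
      rw [Finset.coe_insert, Set.insert_subset_iff] at hS
      refine .mp (σ := τ) (ih hS.2 (Theory.models_sentence_iff.2 fun M => ?_))
        (hS.1.elim .base .hyp)
      refine (Sentence.realize_imp M).2 fun hτ => ?_
      have : M ⊨ (↑(insert τ S) : LTC.Theory) := by
        rw [Finset.coe_insert]
        exact Theory.model_insert_iff.2 ⟨hτ, M.is_model⟩
      exact h'.realize_sentence M

theorem Provable.mono_of_provable {Γ Δ : LTC.Theory} {σ : LTC.Sentence} (h : Provable Γ σ)
    (hΓ : ∀ τ ∈ Γ, Provable Δ τ) : Provable Δ σ := by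
  induction h with
  | base h => exact .base h
  | hyp h => exact hΓ _ h
  | valid h => exact .valid h
  | mp _ _ h₁ h₂ => exact .mp h₁ h₂

theorem isTheory_Cn (Γ : LTC.Theory) : IsTheory (Cn Γ) :=
  fun _ h => h.mono_of_provable fun _ h => h

/-! ### Bounding terms and initial segments -/

/-- Evaluating the bound at larger arguments `ys` builds monotonicity into the statement, so that
bounds compose by substitution. -/
theorem TCFunc.exists_bound {n : ℕ} (f : TCFunc n) : ∃ s : LTC.Term (Fin n),
    ∀ (M : Type) [LTC.Structure M] [M ⊨ BTC] (xs ys : Fin n → M), (∀ j, Le (xs j) (ys j)) →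
      Le (fn f xs) (s.realize ys) := by
  have vec₁ : ∀ (M : Type) (xs : Fin 1 → M), xs = ![xs 0] := fun M xs =>
    funext fun i => by fin_cases i; rfl
  have vec₂ : ∀ (M : Type) (xs : Fin 2 → M), xs = ![xs 0, xs 1] := fun M xs =>
    funext fun i => by fin_cases i <;> rfl
  induction f with
  | zero => exact ⟨tZero, fun M _ _ xs ys h => by
      rw [realize_tZero, zr, Subsingleton.elim xs (![])]; exact Le.refl _⟩
  | succ => exact ⟨tSucc (.var 0), fun M _ _ xs ys h => by
      rw [vec₁ M xs, realize_tSucc]; exact (h 0).sc⟩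
  | half => exact ⟨.var 0, fun M _ _ xs ys h => by
      rw [vec₁ M xs]; exact (hf_le _).trans (h 0)⟩
  | len => exact ⟨tLen (.var 0), fun M _ _ xs ys h => by
      rw [vec₁ M xs, realize_tLen]; exact (h 0).ln⟩
  | add => exact ⟨tAdd (.var 0) (.var 1), fun M _ _ xs ys h => by
      rw [vec₂ M xs, realize_tAdd]; exact (h 0).ad (h 1)⟩
  | mul => exact ⟨tMul (.var 0) (.var 1), fun M _ _ xs ys h => by
      rw [vec₂ M xs, realize_tMul]; exact (h 0).ml (h 1)⟩
  -- Monotonicity is taken from |x # y| = |x||y| + 1; passing from lengths back to values costs the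
  -- factor 2 and the successor.
  | smash => exact ⟨tSucc (tDbl (tSmash (.var 0) (.var 1))), fun M _ _ xs ys h => by
      rw [vec₂ M xs, realize_tSucc, realize_tDbl, realize_tSmash]
      exact le_sc_db_of_ln_le ((h 0).ln_sm (h 1))⟩
  | monus => exact ⟨.var 0, fun M _ _ xs ys h => by
      rw [vec₂ M xs]; exact (mo_le _ _).trans (h 0)⟩
  | msp => exact ⟨.var 0, fun M _ _ xs ys h => by
      rw [vec₂ M xs]; exact (ms_le _ _).trans (h 0)⟩
  | proj j => exact ⟨.var j, fun M _ _ xs ys h => by rw [fn_proj]; exact h j⟩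
  | comp f g ihf ihg =>
    obtain ⟨s, hs⟩ := ihf
    choose r hr using ihg
    refine ⟨s.subst r, fun M _ _ xs ys h => ?_⟩
    rw [fn_comp, Term.realize_subst]
    exact hs M _ _ fun j => hr j M xs ys h
  | search f _ => exact ⟨tLen (.var 0), fun M _ _ xs ys h => by
      rw [← Fin.cons_self_tail xs, realize_tLen]
      exact (search_le f _ _).trans (h 0).ln⟩
  | compr f _ => exact ⟨tSucc (tDbl (tSmash tOne (.var 0))), fun M _ _ xs ys h => by
      rw [← Fin.cons_self_tail xs]
      have := le_sc_db_of_ln_le ((Le.refl (sc (zr M))).ln_sm (h 0))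
      rw [realize_tSucc, realize_tDbl, realize_tSmash, realize_tOne]
      exact ((le_self_sc _).trans (compr_lt f _ _)).trans this⟩
  | count f _ => exact ⟨tLen (.var 0), fun M _ _ xs ys h => by
      rw [← Fin.cons_self_tail xs, realize_tLen]
      exact (count_le f _ _).trans (h 0).ln⟩

theorem exists_monotone_bound {α : Type} (t : LTC.Term α) : ∃ s : LTC.Term α,
    ∀ (M : Type) [LTC.Structure M] [M ⊨ BTC] (xs ys : α → M), (∀ j, Le (xs j) (ys j)) →
      Le (t.realize xs) (s.realize ys) := by
  induction t with
  | var a => exact ⟨.var a, fun M _ _ xs ys h => h a⟩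
  | func f ts ih =>
    obtain ⟨s, hs⟩ := TCFunc.exists_bound f
    choose r hr using ih
    refine ⟨s.subst r, fun M _ _ xs ys h => ?_⟩
    rw [Term.realize_subst]
    exact hs M _ _ fun j => hr j M xs ys h

theorem exists_monotone_bound_list {α : Type} (l : List (LTC.Term α)) : ∃ s : LTC.Term α,
    ∀ t ∈ l, ∀ (M : Type) [LTC.Structure M] [M ⊨ BTC] (xs ys : α → M),
      (∀ j, Le (xs j) (ys j)) → Le (t.realize xs) (s.realize ys) := by
  induction l with
  | nil => exact ⟨tZero, by simp⟩
  | cons t l ih =>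
    obtain ⟨s, hs⟩ := ih
    obtain ⟨r, hr⟩ := exists_monotone_bound t
    refine ⟨tAdd r s, fun t' ht' M _ _ xs ys h => ?_⟩
    rw [realize_tAdd]
    rcases List.mem_cons.1 ht' with rfl | ht'
    · exact (hr M xs ys h).trans (le_ad _ _)
    · exact (hs t' ht' M xs ys h).trans (le_ad' _ _)

/-! ### Absoluteness for initial segments -/

section InitialSegments

variable {M : Type} [LTC.Structure M]

/-- The initial segment of elements bounded by the value of a term at the given elements. -/
def termCut [M ⊨ BTC] {α : Type} (w : α → M) : LTC.Substructure M where
  carrier := {x | ∃ t : LTC.Term α, Le x (t.realize w)}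
  fun_mem f xs h := by
    obtain ⟨s, hs⟩ := TCFunc.exists_bound f
    choose t ht using h
    refine ⟨s.subst t, ?_⟩
    rw [Term.realize_subst]
    exact hs M _ _ ht

theorem mem_termCut [M ⊨ BTC] {α : Type} {w : α → M} {x : M} :
    x ∈ termCut w ↔ ∃ t : LTC.Term α, Le x (t.realize w) := Iff.rfl

variable {S : LTC.Substructure M} {α : Type}

theorem coe_le_coe (x y : S) : Le (x : M) (y : M) ↔ Le x y := by
  have : (fun i => ((![x, y] : Fin 2 → S) i : M)) = ![(x : M), (y : M)] :=
    funext fun i => by fin_cases i <;> rfl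
  rw [Le, ← this]
  rfl

theorem coe_realize (t : LTC.Term α) (w : α → S) :
    ((t.realize w : S) : M) = t.realize fun a => (w a : M) :=
  (HomClass.realize_term S.subtype).symm

theorem coe_sum_elim {k : ℕ} (w : α → S) (xs : Fin k → S) :
    (fun x => ((Sum.elim w xs x : S) : M)) =
      Sum.elim (fun a => (w a : M)) (fun j => (xs j : M)) := by
  funext x
  rcases x with x | x <;> rfl

theorem coe_snoc {k : ℕ} (xs : Fin k → S) (a : S) :
    (fun j => ((Fin.snoc xs a : Fin (k + 1) → S) j : M)) =
      Fin.snoc (fun j => (xs j : M)) (a : M) :=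
  Fin.comp_snoc (g := ((↑) : S → M)) xs a

/-- The values of the bounding terms lie in S, hence so does everything below them: a bounded
quantifier ranges over the same elements in S and in M. -/
theorem IsBounded.realize_coe (hS : ∀ x ∈ S, ∀ y : M, Le y x → y ∈ S) {k : ℕ}
    {φ : LTC.BoundedFormula α k} (h : IsBounded φ) (w : α → S) (xs : Fin k → S) :
    φ.Realize (fun a => (w a : M)) (fun j => (xs j : M)) ↔ φ.Realize w xs := by
  induction h with
  | falsum => exact Iff.rfl
  | eq s t =>
    rw [BoundedFormula.realize_bdEqual, BoundedFormula.realize_bdEqual, ← coe_sum_elim,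
      ← coe_realize, ← coe_realize, Subtype.coe_inj]
  | le s t =>
    rw [realize_leF, realize_leF, ← coe_sum_elim, ← coe_realize, ← coe_realize, coe_le_coe]
  | imp _ _ h₁ h₂ => rw [BoundedFormula.realize_imp, BoundedFormula.realize_imp, h₁, h₂]
  | ball t _ ih =>
    simp only [realize_ballF, ← coe_sum_elim, ← coe_realize]
    constructor
    · intro H a ha
      rw [← ih, coe_snoc]
      exact H a ((coe_le_coe _ _).2 ha)
    · intro H a ha
      have := H ⟨a, hS _ (Subtype.coe_prop _) a ha⟩ ((coe_le_coe _ _).1 ha)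
      rwa [← ih, coe_snoc] at this
  | bex t _ ih =>
    simp only [realize_bexF, ← coe_sum_elim, ← coe_realize]
    constructor
    · rintro ⟨a, ha, H⟩
      refine ⟨⟨a, hS _ (Subtype.coe_prop _) a ha⟩, (coe_le_coe _ _).1 ha, ?_⟩
      rwa [← ih, coe_snoc]
    · rintro ⟨a, ha, H⟩
      rw [← ih, coe_snoc] at H
      exact ⟨a, (coe_le_coe _ _).2 ha, H⟩

/-- Universal quantifiers survive restriction to S, and the witness of a bounded existential
quantifier lies below an element of S. -/
theorem IsPiPlus.realize_of_coe (hS : ∀ x ∈ S, ∀ y : M, Le y x → y ∈ S) {k : ℕ}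
    {φ : LTC.BoundedFormula α k} (h : IsPiPlus φ) (w : α → S) (xs : Fin k → S)
    (H : φ.Realize (fun a => (w a : M)) (fun j => (xs j : M))) : φ.Realize w xs := by
  induction h with
  | bounded h => exact (h.realize_coe hS w xs).1 H
  | all _ ih => exact fun a => ih _ (by rw [coe_snoc]; exact H a)
  | bex t _ ih =>
    simp only [realize_bexF, ← coe_sum_elim, ← coe_realize] at H ⊢
    obtain ⟨a, ha, H⟩ := H
    exact ⟨⟨a, hS _ (Subtype.coe_prop _) a ha⟩, (coe_le_coe _ _).1 ha,
      ih _ (by rw [coe_snoc]; exact H)⟩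

theorem BTCAxiom.isBounded {n : ℕ} {φ : LTC.Formula (Fin n)} (h : BTCAxiom n φ) :
    IsBounded φ := by
  cases h <;>
    repeat' first
      | exact IsBounded.eq _ _
      | exact IsBounded.le _ _
      | with_reducible apply IsBounded.iff
      | with_reducible apply IsBounded.inf
      | with_reducible apply IsBounded.sup
      | with_reducible apply IsBounded.not
      | with_reducible apply IsBounded.imp

theorem IsBounded.realize_formula_coe (hS : ∀ x ∈ S, ∀ y : M, Le y x → y ∈ S)
    {φ : LTC.Formula α} (h : IsBounded φ) (w : α → S) :
    φ.Realize (fun a => (w a : M)) ↔ φ.Realize w := by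
  rw [Formula.Realize, Formula.Realize, ← h.realize_coe hS]
  exact iff_of_eq (congrArg _ (Subsingleton.elim _ _))

theorem models_BTC_of_initial [M ⊨ BTC] (hS : ∀ x ∈ S, ∀ y : M, Le y x → y ∈ S) : S ⊨ BTC := by
  rw [Theory.model_iff]
  rintro σ ⟨n, φ, h, rfl⟩
  rw [realize_univClosure]
  exact fun w => (h.isBounded.realize_formula_coe hS w).1 (h.realize _)

theorem models_of_initial {Γ : LTC.Theory} (hΓ : ∀ σ ∈ Γ, IsPiPlus σ) [M ⊨ Γ]
    (hS : ∀ x ∈ S, ∀ y : M, Le y x → y ∈ S) : S ⊨ Γ := by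
  rw [Theory.model_iff]
  intro σ h
  refine (hΓ σ h).realize_of_coe hS _ _ ?_
  have := Γ.realize_sentence_of_mem (M := M) h
  rw [Sentence.Realize, Formula.Realize] at this
  convert this

end InitialSegments

/-! ### Parikh's theorem -/

/-- A bounded formula implied by universal sentences over a `Π₁⁺` theory follows from finitely many
instances of their restrictions to the values of terms. -/
theorem exists_bounding_terms {Γ : LTC.Theory} (hΓ : ∀ σ ∈ Γ, IsPiPlus σ) {i : ℕ} {ι : Type}
    (ar : ι → ℕ) (ψ : ∀ j, LTC.Formula (Fin (ar j))) (hψ : ∀ j, IsStrict .pi (i + 1) (ψ j))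
    {m : ℕ} {θ : LTC.Formula (Fin m)} (hθ : IsBounded θ)
    (H : ∀ (M : Type) [LTC.Structure M] [M ⊨ BTC] [M ⊨ Γ], (∀ j w, (ψ j).Realize (M := M) w) →
      ∀ w : Fin m → M, θ.Realize w) :
    ∃ l : List (ι × LTC.Term (Fin m)), ∀ (M : Type) [LTC.Structure M] [M ⊨ BTC] [M ⊨ Γ]
      (w : Fin m → M), (∀ p ∈ l, ∀ xs : Fin (ar p.1) → M, (∀ j, Le (xs j) (p.2.realize w)) →
        (ψ p.1).Realize xs) → θ.Realize w := by
  -- Each restriction of ψ below a term must itself be a formula in w, so that compactness applies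
  -- to it.
  have hG : ∀ p : ι × LTC.Term (Fin m), ∃ G : LTC.Formula (Fin m),
      ∀ (M : Type) [LTC.Structure M] (w : Fin m → M), G.Realize w ↔
        ∀ xs : Fin (ar p.1) → M, (∀ j, Le (xs j) (p.2.realize w)) → (ψ p.1).Realize xs := by
    intro p
    obtain ⟨ψ', h', e'⟩ := (hψ p.1).exists_subst (β := Fin m) (m := ar p.1)
      (Sum.elim (fun j => .var (.inr j)) (fun j => j.elim0))
    obtain ⟨G, -, e⟩ := h'.exists_balls p.2
    refine ⟨G, fun M _ w => (e M w).trans (forall_congr' fun xs => imp_congr_right fun _ => ?_)⟩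
    refine (e' M w xs).trans (iff_of_eq ?_)
    exact congrArg₂ _ (funext fun j => rfl) (Subsingleton.elim _ _)
  choose G hG using hG
  -- The parameters w become new constants; the theory asserts all restrictions to all terms at
  -- once.
  let Θ : LTC[[Fin m]].Theory := (LTC.lhomWithConstants (Fin m)).onTheory (BTC ∪ Γ) ∪
    (fun p => Formula.equivSentence (G p)) '' Set.univ
  have key : Θ ⊨ᵇ Formula.equivSentence θ := by
    refine Theory.models_sentence_iff.2 fun M => ?_
    let := (LTC.lhomWithConstants (Fin m)).reduct M
    rw [Formula.realize_equivSentence]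
    obtain ⟨h₁, h₂⟩ := Theory.model_union_iff.1 M.is_model
    obtain ⟨_, _⟩ := Theory.model_union_iff.1 ((LHom.onTheory_model _ _).1 h₁)
    set w : Fin m → M := fun a => (LTC.con a : M)
    have h₃ : ∀ p, (G p).Realize w := fun p =>
      (Formula.realize_equivSentence M _).1
        (Theory.realize_sentence_of_mem ((fun p => Formula.equivSentence (G p)) '' Set.univ)
          (Set.mem_image_of_mem _ (Set.mem_univ p)))
    -- Every element of S lies below a term in w, so in S the restricted formulas amount to the full
    -- ψ_j. Hence θ(w) holds in S, and in M because θ is bounded.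
    let S := termCut w
    have hS : ∀ x ∈ S, ∀ y : M, Le y x → y ∈ S := fun x ⟨t, ht⟩ y hy => ⟨t, hy.trans ht⟩
    have : S ⊨ BTC := models_BTC_of_initial hS
    have : S ⊨ Γ := models_of_initial hΓ hS
    let w' : Fin m → S := fun a => ⟨w a, .var a, Le.refl _⟩
    refine (hθ.realize_formula_coe hS w').2 (H S (fun j xs => ?_) w')
    refine ((hψ j).isBounded.realize_formula_coe hS xs).1 ?_
    choose t ht using fun a => mem_termCut.1 (xs a).2
    -- The restrictions use one term for all coordinates, so the bounds of the coordinates are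
    -- merged.
    obtain ⟨s, hs⟩ := exists_monotone_bound_list (List.ofFn t)
    exact (hG (j, s) M w).1 (h₃ _) _ fun a =>
      (ht a).trans (hs _ (List.mem_ofFn.2 ⟨a, rfl⟩) M w w fun _ => Le.refl _)
  obtain ⟨T₀, hT₀, h⟩ := Theory.models_iff_finset_models.1 key
  classical
  -- Only finitely many restrictions occur in the finite subtheory; F collects their indices.
  obtain ⟨F, -, hF⟩ := Finset.subset_set_image_iff.1
    (show (↑(T₀.filter (· ∈ (fun p => Formula.equivSentence (G p)) '' Set.univ)) :
      Set (LTC[[Fin m]].Sentence)) ⊆ (fun p => Formula.equivSentence (G p)) '' Set.univ from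
      fun σ hσ => (Finset.mem_filter.1 hσ).2)
  refine ⟨F.toList, fun M _ _ _ w hw => ?_⟩
  let : (constantsOn (Fin m)).Structure M := constantsOn.structure w
  have : Nonempty M := ⟨zr M⟩
  have : M ⊨ (LTC.lhomWithConstants (Fin m)).onTheory (BTC ∪ Γ) :=
    (LHom.onTheory_model _ _).2 (Theory.model_union_iff.2 ⟨inferInstance, inferInstance⟩)
  have : M ⊨ (T₀ : LTC[[Fin m]].Theory) := by
    rw [Theory.model_iff]
    intro σ hσ
    rcases hT₀ hσ with h' | h'
    · exact Theory.realize_sentence_of_mem _ h'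
    · have h'' : σ ∈ F.image (fun p => Formula.equivSentence (G p)) :=
        hF ▸ Finset.mem_filter.2 ⟨hσ, h'⟩
      obtain ⟨p, hp, rfl⟩ := Finset.mem_image.1 h''
      exact (Formula.realize_equivSentence M _).2
        ((hG p M _).2 (hw p (Finset.mem_toList.2 hp)))
  exact (Formula.realize_equivSentence M _).1 (h.realize_sentence M)

/-! ### Induction schemes -/

/-- A notion of induction: `φ` is inductive if `φ(0)` holds and `φ(pre e)` implies `φ(post e)`.
Every element `u` is reached from `0` in `time u` many steps through the elements `approx u k`,
`k ≤ time u`. -/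
structure InductionScheme where
  pre : LTC.Term (Fin 1)
  post : LTC.Term (Fin 1)
  time : LTC.Term (Fin 1)
  approx : LTC.Term (Fin 2)
  time_mono : ∀ {M : Type} [LTC.Structure M] [M ⊨ BTC] {x y : M}, Le x y →
    Le (time.realize ![x]) (time.realize ![y])
  time_zero : ∀ {M : Type} [LTC.Structure M] [M ⊨ BTC], time.realize ![zr M] = zr M
  time_step : ∀ {M : Type} [LTC.Structure M] [M ⊨ BTC] (e : M),
    time.realize ![post.realize ![e] ] = time.realize ![pre.realize ![e] ] ∨
      time.realize ![post.realize ![e] ] = sc (time.realize ![pre.realize ![e] ])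
  time_unbounded : ∀ {M : Type} [LTC.Structure M] [M ⊨ BTC] (x y : M),
    ∃ w : M, Le (ad (time.realize ![x]) (time.realize ![y])) (time.realize ![w])
  approx_zero : ∀ {M : Type} [LTC.Structure M] [M ⊨ BTC] (u : M),
    approx.realize ![u, zr M] = zr M
  -- The stages may stand still, as they do after reaching u. The bound e ≤ u ensures that only
  -- premises at elements up to u are used.
  approx_step : ∀ {M : Type} [LTC.Structure M] [M ⊨ BTC] (u k : M),
    approx.realize ![u, sc k] = approx.realize ![u, k] ∨
      ∃ e, Le e u ∧ approx.realize ![u, k] = pre.realize ![e] ∧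
        approx.realize ![u, sc k] = post.realize ![e]
  approx_eq : ∀ {M : Type} [LTC.Structure M] [M ⊨ BTC] {u k : M}, Le (time.realize ![u]) k →
    approx.realize ![u, k] = u

namespace InductionScheme

/-- Induction on values. -/
def succInduction : InductionScheme where
  pre := .var 0
  post := tSucc (.var 0)
  time := .var 0
  -- This is min(u, k).
  approx := tMonus (.var 0) (tMonus (.var 0) (.var 1))
  time_mono h := h
  time_zero := rfl
  time_step e := Or.inr (by simp)
  time_unbounded x y := ⟨_, Le.refl _⟩
  approx_zero u := by simpa [mo_zr] using mo_eq_zr (Le.refl u)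
  approx_step u k := by
    simp only [realize_tMonus, realize_tSucc, Term.realize_var, Matrix.cons_val_zero,
      Matrix.cons_val_one]
    by_cases h : Le u k
    · rw [mo_eq_zr h, mo_eq_zr h.le_sc]
      exact Or.inl rfl
    · have := sc_le_of_not_le h
      have h' := (le_self_sc k).trans this
      exact Or.inr ⟨k, h', mo_mo h', mo_mo this⟩
  approx_eq {M _ _ u k} h := by
    simp only [Term.realize_var, Matrix.cons_val_zero] at h
    simp [mo_eq_zr h, mo_zr]

/-- Polynomial induction. -/
def halfInduction : InductionScheme where
  pre := tHalf (.var 0)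
  post := .var 0
  time := tLen (.var 0)
  -- The leading k bits of u; each further stage appends one bit.
  approx := tMsp (.var 0) (tMonus (tLen (.var 0)) (.var 1))
  time_mono h := by simpa using h.ln
  time_zero {M _ _} := by rw [realize_tLen]; exact ln_zr
  time_step {M _ _} e := by
    by_cases h : e = zr M
    · simp [h, hf_zr]
    · exact Or.inr (by simpa using ln_eq_sc_ln_hf h)
  time_unbounded {M _ _} x y := by
    -- The length of this product is (|x| + 1)(|y| + 1) + 1, which exceeds |x| + |y|.
    refine ⟨sm (sc (db x)) (sc (db y)), ?_⟩
    simp only [realize_tLen, Term.realize_var, Matrix.cons_val_zero, ln_sm, ln_sc_db]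
    rw [ml_sc, ad_sc, ml_comm, ml_sc, ad_comm (ln x)]
    exact ((((le_ad' _ _).ad (Le.refl _)).le_sc).le_sc)
  approx_zero u := by simpa [mo_zr] using ms_eq_zr (Le.refl (ln u))
  approx_step u k := by
    simp only [realize_tMonus, realize_tMsp, realize_tHalf, realize_tLen, Term.realize_var,
      Matrix.cons_val_zero, Matrix.cons_val_one]
    by_cases h : Le (ln u) k
    · rw [mo_eq_zr h, mo_eq_zr h.le_sc]
      exact Or.inl rfl
    · rw [mo_eq_sc_mo_sc (sc_le_of_not_le h), ms_sc]
      exact Or.inr ⟨_, ms_le _ _, rfl, rfl⟩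
  approx_eq {M _ _ u k} h := by
    simp only [realize_tLen, Term.realize_var, Matrix.cons_val_zero] at h
    simp [mo_eq_zr h, ms_zr]

/-! ### Merging two nested inductions into one -/

variable (s : InductionScheme)

/-- The premises of the induction rule for `φ` hold in `M`. -/
def Inductive (M : Type) [LTC.Structure M] {n : ℕ} (φ : LTC.Formula (Fin (n + 1))) : Prop :=
  ∀ (e : M) (w : Fin n → M), φ.Realize (Fin.cons (zr M) w : Fin (n + 1) → M) ∧
    (φ.Realize (Fin.cons (s.pre.realize ![e]) w : Fin (n + 1) → M) →
      φ.Realize (Fin.cons (s.post.realize ![e]) w : Fin (n + 1) → M))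

theorem realize_subst_one {M : Type} [LTC.Structure M] {α : Type} (t : LTC.Term (Fin 1))
    (a : LTC.Term α) (w : α → M) : (t.subst ![a]).realize w = t.realize ![a.realize w] := by
  rw [Term.realize_subst, realize_vec₁]

theorem realize_subst_two {M : Type} [LTC.Structure M] {α : Type} (t : LTC.Term (Fin 2))
    (a b : LTC.Term α) (w : α → M) :
    (t.subst ![a, b]).realize w = t.realize ![a.realize w, b.realize w] := by
  rw [Term.realize_subst, realize_vec₂]

theorem exists_formula_subst {α β : Type} {c : Kind} {i : ℕ} {φ : LTC.Formula α}
    (h : IsStrict c i φ) (σ : α → LTC.Term β) : ∃ ψ : LTC.Formula β, IsStrict c i ψ ∧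
      ∀ (M : Type) [LTC.Structure M] (w : β → M),
        ψ.Realize w ↔ φ.Realize fun a => (σ a).realize w := by
  obtain ⟨ψ, hψ, e⟩ := h.exists_subst (β := β) (m := 0)
    (Sum.elim (fun a => (σ a).relabel Sum.inl) (fun j => j.elim0))
  refine ⟨ψ, hψ, fun M _ w => (e M w _).trans (iff_of_eq ?_)⟩
  refine congrArg₂ _ (funext fun a => ?_) (Subsingleton.elim _ _)
  simp

/-- The statement that `φ` is inductive is a bounded formula. -/
theorem exists_inductive_formula {c : Kind} {i n : ℕ} {φ : LTC.Formula (Fin (n + 1))}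
    (h : IsStrict c i φ) : ∃ θ : LTC.Formula (Fin (n + 1)), IsBounded θ ∧
      ∀ (M : Type) [LTC.Structure M] (e : M) (w : Fin n → M),
        θ.Realize (Fin.cons e w : Fin (n + 1) → M) ↔
          φ.Realize (Fin.cons (zr M) w : Fin (n + 1) → M) ∧
            (φ.Realize (Fin.cons (s.pre.realize ![e]) w : Fin (n + 1) → M) →
              φ.Realize (Fin.cons (s.post.realize ![e]) w : Fin (n + 1) → M)) := by
  have key : ∀ t : LTC.Term (Fin (n + 1)), ∃ ψ : LTC.Formula (Fin (n + 1)), IsStrict c i ψ ∧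
      ∀ (M : Type) [LTC.Structure M] (e : M) (w : Fin n → M),
        ψ.Realize (Fin.cons e w : Fin (n + 1) → M) ↔
          φ.Realize (Fin.cons (t.realize (Fin.cons e w : Fin (n + 1) → M)) w :
            Fin (n + 1) → M) := by
    intro t
    obtain ⟨ψ, hψ, e⟩ := exists_formula_subst h (Fin.cons t fun j => .var j.succ)
    refine ⟨ψ, hψ, fun M _ a w => (e M _).trans (iff_of_eq (congrArg _ (funext fun j => ?_)))⟩
    refine Fin.cases ?_ (fun j => ?_) j <;> simp
  obtain ⟨φ₀, h₀, e₀⟩ := key tZero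
  obtain ⟨φ₁, h₁, e₁⟩ := key (s.pre.subst ![.var 0])
  obtain ⟨φ₂, h₂, e₂⟩ := key (s.post.subst ![.var 0])
  refine ⟨φ₀ ⊓ φ₁.imp φ₂, h₀.isBounded.inf (h₁.isBounded.imp h₂.isBounded), fun M _ e w => ?_⟩
  rw [Formula.realize_inf, Formula.realize_imp, e₀, e₁, e₂, realize_tZero, realize_subst_one,
    realize_subst_one]
  exact Iff.rfl

/-- A single formula expressing that finitely many formulas have been reached, up to a bound, and
that another formula follows once they have been. -/
theorem exists_two_phase_formula {i n : ℕ} {φ : LTC.Formula (Fin (n + 1))}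
    (hφ : IsStrict .pi (i + 1) φ) {ι : Type} (ar : ι → ℕ)
    {ψ : ∀ j, LTC.Formula (Fin (ar j + 1))} (hψ : ∀ j, IsStrict .pi (i + 1) (ψ j)) (l : List ι)
    (b : LTC.Term (Fin (n + 1))) :
    ∃ χ : LTC.Formula (Fin (n + 1 + 1)), IsStrict .pi (i + 1) χ ∧
      ∀ (M : Type) [LTC.Structure M] [M ⊨ BTC] (a : M) (w : Fin (n + 1) → M),
        χ.Realize (Fin.cons a w : Fin (n + 1 + 1) → M) ↔
          (∀ p ∈ l, ∀ xs : Fin (ar p + 1) → M, (∀ j, Le (xs j) (b.realize w)) →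
            (ψ p).Realize (Fin.cons (s.approx.realize ![xs 0, s.time.realize ![a] ])
              (Fin.tail xs) : Fin (ar p + 1) → M)) ∧
          (Le (s.time.realize ![b.realize w]) (s.time.realize ![a]) →
            φ.Realize (Fin.cons (s.approx.realize
              ![w 0, mo (s.time.realize ![a]) (s.time.realize ![b.realize w])])
              (Fin.tail w) : Fin (n + 1) → M)) := by
  have h₁ : ∀ p, ∃ χ : LTC.Formula (Fin (n + 1 + 1)), IsStrict .pi (i + 1) χ ∧
      ∀ (M : Type) [LTC.Structure M] (a : M) (w : Fin (n + 1) → M),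
        χ.Realize (Fin.cons a w : Fin (n + 1 + 1) → M) ↔
          ∀ xs : Fin (ar p + 1) → M, (∀ j, Le (xs j) (b.realize w)) →
            (ψ p).Realize (Fin.cons (s.approx.realize ![xs 0, s.time.realize ![a] ])
              (Fin.tail xs) : Fin (ar p + 1) → M) := by
    intro p
    obtain ⟨ψ', h', e'⟩ := (hψ p).exists_subst (β := Fin (n + 1 + 1)) (m := ar p + 1)
      (Sum.elim (Fin.cons (s.approx.subst ![.var (.inr 0), s.time.subst ![.var (.inl 0)] ])
        (fun j => .var (.inr j.succ))) (fun j => j.elim0))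
    obtain ⟨χ, hχ, e⟩ := h'.exists_balls (b.relabel Fin.succ)
    refine ⟨χ, hχ, fun M _ a w => (e M _).trans (forall_congr' fun xs => imp_congr ?_ ?_)⟩
    · rw [Term.realize_relabel]
      exact Iff.rfl
    · refine (e' M _ xs).trans (iff_of_eq (congrArg₂ _ (funext fun j => ?_)
        (Subsingleton.elim _ _)))
      refine Fin.cases ?_ (fun j => ?_) j
      · simp only [Sum.elim_inl, Fin.cons_zero, realize_subst_one, realize_subst_two]
        rfl
      · simp [Fin.tail]
  choose χ₁ hχ₁ e₁ using h₁
  obtain ⟨χ₂, hχ₂, e₂⟩ := IsStrict.exists_forall_list l (φ := χ₁) (fun p _ => hχ₁ p)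
  obtain ⟨χ₃, hχ₃, e₃⟩ := exists_formula_subst (β := Fin (n + 1 + 1)) hφ
    (Fin.cons (s.approx.subst ![.var 1, tMonus (s.time.subst ![.var 0])
      (s.time.subst ![b.relabel Fin.succ])]) (fun j => .var j.succ.succ))
  -- The negated guard is quantifier-free, so its disjunction with φ stays in the class.
  let δ : LTC.Formula (Fin (n + 1 + 1)) :=
    (leF ((s.time.subst ![b.relabel Fin.succ]).relabel Sum.inl)
      ((s.time.subst ![.var 0]).relabel Sum.inl)).imp ⊥
  have hδ : IsSharplyBounded δ := (IsSharplyBounded.le _ _).imp .falsum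
  obtain ⟨χ₄, hχ₄, e₄⟩ := (hδ.isStrict .pi (i + 1)).exists_op positive_or hχ₃
  obtain ⟨χ, hχ, e⟩ := hχ₂.exists_op positive_and hχ₄
  refine ⟨χ, hχ, fun M _ _ a w => (e M _ _).trans (and_congr ?_ ((e₄ M _ _).trans ?_))⟩
  · rw [e₂]
    exact forall₂_congr fun p _ => e₁ p M a w
  · rw [imp_iff_not_or]
    refine or_congr (not_congr ?_) ((e₃ M _).trans (iff_of_eq (congrArg _ (funext fun j => ?_))))
    · rw [realize_leF]
      simp only [Term.realize_relabel, Sum.elim_comp_inl, realize_subst_one]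
      exact Iff.rfl
    · refine Fin.cases ?_ (fun j => ?_) j
      · simp only [Fin.cons_zero, realize_subst_two, realize_tMonus, realize_subst_one,
          Term.realize_relabel]
        rfl
      · simp [Fin.tail]

/-- A formula that is inductive provably from consequences of the induction rule can be replaced by
a formula that is inductive already in the original theory. -/
theorem exists_unnested {Γ : LTC.Theory} (hΓ : ∀ σ ∈ Γ, IsPiPlus σ) {i n : ℕ}
    {φ : LTC.Formula (Fin (n + 1))} (hφ : IsStrict .pi (i + 1) φ) {ι : Type} (ar : ι → ℕ)
    {ψ : ∀ j, LTC.Formula (Fin (ar j + 1))} (hψ : ∀ j, IsStrict .pi (i + 1) (ψ j))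
    (hind : ∀ (M : Type) [LTC.Structure M] [M ⊨ BTC] [M ⊨ Γ] (j : ι), s.Inductive M (ψ j))
    (H : ∀ (M : Type) [LTC.Structure M] [M ⊨ BTC] [M ⊨ Γ], (∀ j w, (ψ j).Realize (M := M) w) →
      s.Inductive M φ) :
    ∃ χ : LTC.Formula (Fin (n + 1 + 1)), IsStrict .pi (i + 1) χ ∧
      (∀ (M : Type) [LTC.Structure M] [M ⊨ BTC] [M ⊨ Γ], s.Inductive M χ) ∧
      ∀ (M : Type) [LTC.Structure M] [M ⊨ BTC], (∀ w, χ.Realize (M := M) w) →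
        ∀ w, φ.Realize (M := M) w := by
  -- The implication in the premises leaves the class of φ, but Parikh's theorem only needs θ to be
  -- bounded.
  obtain ⟨θ, hθ, eθ⟩ := s.exists_inductive_formula hφ
  obtain ⟨l, hl⟩ := exists_bounding_terms hΓ (fun j => ar j + 1) ψ hψ hθ (fun M _ _ _ h w => by
    rw [← Fin.cons_self_tail w, eθ]
    exact H M h _ _)
  obtain ⟨b, hb⟩ := exists_monotone_bound_list (l.map Prod.snd)
  obtain ⟨χ, hχ, e⟩ := s.exists_two_phase_formula hφ ar hψ (l.map Prod.fst) b
  refine ⟨χ, hχ, fun M _ _ _ => ?_, fun M _ _ h w => ?_⟩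
  · intro d w
    rw [e M, e M, e M, s.time_zero]
    let A : M → Prop := fun k => ∀ p ∈ l.map Prod.fst, ∀ xs : Fin (ar p + 1) → M,
      (∀ j, Le (xs j) (b.realize w)) → (ψ p).Realize
        (Fin.cons (s.approx.realize ![xs 0, k]) (Fin.tail xs) : Fin (ar p + 1) → M)
    let B : M → Prop := fun k => Le (s.time.realize ![b.realize w]) k → φ.Realize
      (Fin.cons (s.approx.realize ![w 0, mo k (s.time.realize ![b.realize w])]) (Fin.tail w) :
        Fin (n + 1) → M)
    -- Once the clock has passed `time b(w)`, all stages below b(w) are complete, so A gives the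
    -- restricted ψ_p themselves. By monotonicity b(w) covers the terms evaluated at x and the
    -- remaining parameters for every x ≤ w₀.
    have full : ∀ k, A k → Le (s.time.realize ![b.realize w]) k → ∀ x, Le x (w 0) →
        φ.Realize (Fin.cons (zr M) (Fin.tail w) : Fin (n + 1) → M) ∧
          (φ.Realize (Fin.cons (s.pre.realize ![x]) (Fin.tail w) : Fin (n + 1) → M) →
            φ.Realize (Fin.cons (s.post.realize ![x]) (Fin.tail w) : Fin (n + 1) → M)) := by
      intro k hk hbk x hx
      rw [← eθ]
      refine hl M _ fun p hp xs hxs => ?_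
      have hxs' : ∀ j, Le (xs j) (b.realize w) := fun j => by
        refine (hxs j).trans (hb _ (List.mem_map_of_mem hp) M _ _ fun j => ?_)
        refine Fin.cases hx (fun j => ?_) j
        exact Le.refl _
      have := hk _ (List.mem_map_of_mem hp) xs hxs'
      rwa [s.approx_eq ((s.time_mono (hxs' 0)).trans hbk), Fin.cons_self_tail] at this
    have A_zero : A (zr M) := fun p _ xs _ => by
      rw [s.approx_zero]
      exact (hind M p (zr M) _).1
    have A_step : ∀ k, A k → A (sc k) := fun k hk p hp xs hxs => by
      rcases s.approx_step (xs 0) k with h | ⟨x, -, h, h'⟩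
      · rw [h]
        exact hk p hp xs hxs
      · rw [h']
        refine (hind M p x _).2 ?_
        rw [← h]
        exact hk p hp xs hxs
    have B_zero : B (zr M) := fun h => by
      rw [mo_eq_zr (zr_le _), s.approx_zero]
      exact (full _ A_zero h _ (Le.refl _)).1
    -- A is needed at k + 1, since the guard may become true only there; in that case φ has to hold
    -- at stage 0.
    have B_step : ∀ k, A k → B k → B (sc k) := fun k hA hB hk => by
      have := full _ (A_step k hA) hk
      by_cases hbk : Le (s.time.realize ![b.realize w]) k
      · rw [sc_mo hbk]
        rcases s.approx_step (w 0) (mo k (s.time.realize ![b.realize w])) with h | ⟨x, hx, h, h'⟩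
        · rw [h]
          exact hB hbk
        · rw [h']
          refine (this x hx).2 ?_
          rw [← h]
          exact hB hbk
      · rw [mo_eq_zr (sc_le_of_not_le hbk), s.approx_zero]
        exact (this _ (Le.refl _)).1
    refine ⟨⟨A_zero, B_zero⟩, fun h => ?_⟩
    -- One step of the rule moves the clock by at most one; it stands still for PIND at 0.
    rcases s.time_step d with h' | h' <;> rw [h']
    · exact h
    · exact ⟨A_step _ h.1, B_step _ h.1 h.2⟩
  -- There is enough time for both phases: `time b(w)` for the ψ_p, then `time w₀` for φ.
  · obtain ⟨a, ha⟩ := s.time_unbounded (w 0) (b.realize w)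
    have hba := (le_ad' _ _).trans ha
    have := ((e M a w).1 (h _)).2 hba
    rwa [s.approx_eq, Fin.cons_self_tail] at this
    rw [← mo_ad hba, ad_comm, ad_comm (mo _ _)] at ha
    exact ad_le_ad_left_iff.1 ha

/-- `r` is the instance of the induction rule given by `φ`. -/
def IsInstance (r : RuleInstance) {n : ℕ} (φ : LTC.Formula (Fin (n + 1))) : Prop :=
  r.conclusion = univClosure φ ∧
    ∀ (M : Type) [LTC.Structure M] [M ⊨ BTC], (∀ σ ∈ r.premises, M ⊨ σ) ↔ s.Inductive M φ

theorem ruleClosure_eq_unnestedClosure {T : LTC.Theory} (hT : IsPiPlusAxiomatized T) {i : ℕ}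
    {R : Rule}
    (hR : ∀ r ∈ R, ∃ (n : ℕ) (φ : LTC.Formula (Fin (n + 1))), IsPiHat (i + 1) φ ∧
      s.IsInstance r φ)
    (hR' : ∀ (n : ℕ) (φ : LTC.Formula (Fin (n + 1))), IsPiHat (i + 1) φ → ∃ r ∈ R,
      s.IsInstance r φ) : ruleClosure T R = unnestedClosure T R := by
  obtain ⟨Γ, hΓ, rfl⟩ := hT
  have models_Cn : ∀ (M : Type) [LTC.Structure M] [M ⊨ BTC] [M ⊨ Γ], M ⊨ Cn Γ := fun M _ _ _ =>
    (Theory.model_iff _).2 fun σ hσ => provable_iff.1 hσ M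
  have models_Γ : ∀ (M : Type) [LTC.Structure M] [M ⊨ Cn Γ], M ⊨ Γ := fun M _ h =>
    h.mono fun σ hσ => Provable.hyp hσ
  refine Set.Subset.antisymm ?_ ?_
  · refine Set.sInter_subset_of_mem ⟨isTheory_Cn _, fun σ hσ => .hyp (.inl hσ), ?_⟩
    intro r hr hprem
    obtain ⟨n, φ, hφ, hc, he⟩ := hR r hr
    -- All formulas of the class that are inductive over Γ: their universal closures include every
    -- conclusion added in [T, R]. Parikh's theorem selects finitely many.
    let ι := {p : Σ k, LTC.Formula (Fin (k + 1)) // IsPiHat (i + 1) p.2 ∧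
      ∀ (M : Type) [LTC.Structure M] [M ⊨ BTC] [M ⊨ Γ], s.Inductive M p.2}
    obtain ⟨χ, hχ, hind, hcon⟩ := s.exists_unnested hΓ hφ (ι := ι) (fun p => p.1.1)
      (ψ := fun p => p.1.2) (fun p => p.2.1) (fun M _ _ _ p => p.2.2 M) (fun M _ _ _ h => by
        refine (he M).1 fun σ hσ => ?_
        have := models_Cn M
        suffices M ⊨ Cn Γ ∪ {σ | ∃ r ∈ R, (∀ τ ∈ r.premises, Provable (Cn Γ) τ) ∧
            σ = r.conclusion} from provable_iff.1 (hprem hσ) M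
        refine Theory.model_union_iff.2 ⟨this, (Theory.model_iff _).2 ?_⟩
        rintro τ ⟨r', hr', hp, rfl⟩
        obtain ⟨n', φ', hφ', hc', he'⟩ := hR r' hr'
        rw [hc', realize_univClosure]
        refine h ⟨⟨n', φ'⟩, hφ', fun M' _ _ _ => (he' M').1 fun τ hτ => ?_⟩
        have := models_Cn M'
        exact provable_iff.1 (hp τ hτ) M')
    -- The single instance of the rule for χ has premises provable in T, hence is an unnested
    -- application.
    obtain ⟨r', hr', hc', he'⟩ := hR' _ χ hχ
    refine provable_iff.2 fun M _ _ hM => ?_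
    have hM' : M ⊨ r'.conclusion := hM.realize_of_mem _
      (Set.mem_union_right _ ⟨r', hr', fun τ hτ => provable_iff.2 fun M' _ _ _ => ?_,
        rfl⟩)
    · rw [hc', realize_univClosure] at hM'
      rw [hc, realize_univClosure]
      exact hcon M hM'
    · have := models_Γ M'
      exact (he' M').2 (hind M') τ hτ
  · rintro σ hσ T' ⟨hT', hsub, hclosed⟩
    refine hT' _ (hσ.mono_of_provable ?_)
    rintro τ (hτ | ⟨r, hr, hp, rfl⟩)
    · exact .hyp (hsub hτ)
    · exact .hyp (hclosed r hr fun τ hτ =>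
        hT' _ ((hp τ hτ).mono_of_provable fun _ h => .hyp (hsub h)))

end InductionScheme

/-! ### IND and PIND as instances of the scheme -/

theorem realize_instF {M : Type} [LTC.Structure M] {n : ℕ} (φ : LTC.Formula (Fin (n + 1)))
    (t : LTC.Term (Fin (n + 1))) (e : M) (w : Fin n → M) :
    (instF φ t).Realize (Fin.cons e w : Fin (n + 1) → M) ↔
      φ.Realize (Fin.cons (t.realize (Fin.cons e w : Fin (n + 1) → M)) w : Fin (n + 1) → M) := by
  rw [instF, Formula.Realize, BoundedFormula.realize_subst]
  refine iff_of_eq (congrArg₂ _ (funext fun j => ?_) rfl)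
  refine Fin.cases ?_ (fun j => ?_) j <;> simp

theorem forall_cons_iff {M : Type} {n : ℕ} {P : (Fin (n + 1) → M) → Prop} :
    (∀ w, P w) ↔ ∀ (e : M) (w : Fin n → M), P (Fin.cons e w) :=
  Fin.forall_fin_succ_pi

theorem isInstance_IND {n : ℕ} {φ : LTC.Formula (Fin (n + 1))} {r : RuleInstance}
    (h : r.premises = {univClosure (instF φ tZero),
      univClosure (φ.imp (instF φ (tSucc (.var 0))))}) (h' : r.conclusion = univClosure φ) :
    InductionScheme.succInduction.IsInstance r φ := by
  refine ⟨h', fun M _ _ => ?_⟩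
  simp only [h, Set.mem_insert_iff, Set.mem_singleton_iff, forall_eq_or_imp, forall_eq,
    realize_univClosure, forall_cons_iff, Formula.realize_imp, realize_instF, realize_tZero,
    realize_tSucc, InductionScheme.Inductive, InductionScheme.succInduction, forall_and]
  exact Iff.rfl

theorem isInstance_PIND {n : ℕ} {φ : LTC.Formula (Fin (n + 1))} {r : RuleInstance}
    (h : r.premises = {univClosure (instF φ tZero),
      univClosure ((instF φ (tHalf (.var 0))).imp φ)}) (h' : r.conclusion = univClosure φ) :
    InductionScheme.halfInduction.IsInstance r φ := by
  refine ⟨h', fun M _ _ => ?_⟩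
  simp only [h, Set.mem_insert_iff, Set.mem_singleton_iff, forall_eq_or_imp, forall_eq,
    realize_univClosure, forall_cons_iff, Formula.realize_imp, realize_instF, realize_tZero,
    realize_tHalf, InductionScheme.Inductive, InductionScheme.halfInduction, forall_and]
  exact Iff.rfl

end BoundedArithmetic

theorem theorem3p5 (T : BoundedArithmetic.LTC.Theory)
    (hT : BoundedArithmetic.IsPiPlusAxiomatized T) (i : ℕ) (hi : 0 < i) :
    BoundedArithmetic.ruleClosure T (BoundedArithmetic.piHatIND i) =
        BoundedArithmetic.unnestedClosure T (BoundedArithmetic.piHatIND i) ∧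
      BoundedArithmetic.ruleClosure T (BoundedArithmetic.piHatPIND i) =
        BoundedArithmetic.unnestedClosure T (BoundedArithmetic.piHatPIND i) := by
  open BoundedArithmetic in
  obtain ⟨i, rfl⟩ := Nat.exists_eq_add_one.2 hi
  constructor
  · refine InductionScheme.succInduction.ruleClosure_eq_unnestedClosure hT (i := i) ?_ ?_
    · rintro r ⟨n, φ, hφ, h, h'⟩
      exact ⟨n, φ, hφ, isInstance_IND h h'⟩
    · exact fun n φ hφ => ⟨⟨_, Set.toFinite _, _⟩, ⟨n, φ, hφ, rfl, rfl⟩, isInstance_IND rfl rfl⟩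
  · refine InductionScheme.halfInduction.ruleClosure_eq_unnestedClosure hT (i := i) ?_ ?_
    · rintro r ⟨n, φ, hφ, h, h'⟩
      exact ⟨n, φ, hφ, isInstance_PIND h h'⟩
    · exact fun n φ hφ => ⟨⟨_, Set.toFinite _, _⟩, ⟨n, φ, hφ, rfl, rfl⟩, isInstance_PIND rfl rfl⟩
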